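/- Let $\Omega\subset\mathbb{R}^n$ be a bounded open set (for instance a bounded Lipschitz domain) with Lebesgue measure, and equip $\mathbb{R}^{N\times n}$ with the Euclidean (Frobenius) inner product $z\cdot z'$ and norm $|z|$. Let $F\in C^1(\mathbb{R}^{N\times n})$ be a convex real-valued function such that, for some constants $0<\nu\le L<\infty$, $$\nu|z|-L\le F(z)\le L(1+|z|)\qquad\text{for all } z\in\mathbb{R}^{N\times n},$$ with recession function $F^\infty(z):=\lim_{t\searrow 0}tF(z/t)$ and conjugate function $F^*(z^*):=\sup_{z}\{z^*\cdot z-F(z)\}\in\mathbb{R}\cup\{\infty\}$. Let $T_0\in L^\infty(\Omega;\mathbb{R}^{N\times n})$ satisfy $$\operatorname*{ess\,inf}_{x\in\Omega}\ \min_{|\xi|=1}\big\{F^\infty(\xi)-T_0(x)\cdot\xi\big\}>0.$$ The primal problem is to minimise $$\mathcal{F}[w]:=\int_\Omega \big(F(\nabla w)-T_0\cdot\nabla w\big)\,dx\qquad\text{among all } w\in W^{1,1}(\Omega;\mathbb{R}^N),$$ and the dual problem is to maximise $$\mathcal{R}_{T_0}[\chi]:=-\int_\Omega F^*(T_0+\chi)\,dx\in\mathbb{R}\cup\{-\infty\}\qquad\text{among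 all } \chi\in L^\infty_\perp(\Omega;\mathbb{R}^{N\times n}),$$ where $L^\infty_\perp(\Omega;\mathbb{R}^{N\times n})$ is the set of all $\chi\in L^\infty(\Omega;\mathbb{R}^{N\times n})$ with $\int_\Omega\chi\cdot\nabla w\,dx=0$ for all $w\in W^{1,1}(\Omega;\mathbb{R}^N)$. Then the dual problem has a unique maximiser $\sigma$. If $(u_k)_{k\in\mathbb{N}}$ is any minimising sequence of the primal problem, i.e. $u_k\in W^{1,1}(\Omega;\mathbb{R}^N)$ and $\mathcal{F}[u_k]\to\inf_{W^{1,1}(\Omega;\mathbb{R}^N)}\mathcal{F}$, then the sequence $(\mathrm{D}_zF(\nabla u_k)-T_0)_{k\in\mathbb{N}}$ lies in $L^\infty(\Omega;\mathbb{R}^{N\times n})$ and converges to $\sigma$ weakly-$*$ in $L^\infty(\Omega;\mathbb{R}^{N\times n})$. Moreover, $$\inf_{W^{1,1}(\Omega;\mathbb{R}^N)}\mathcal{F}=\sup_{L^\infty_\perp(\Omega;\mathbb{R}^{N\times n})}\mathcal{R}_{T_0}.$$ -/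

import Mathlib

open MeasureTheory Filter Topology
open scoped ENNReal ContDiff

noncomputable section

namespace NeumannDuality

/-- Euclidean space `ℝⁿ`. -/
abbrev Vec (n : ℕ) : Type := EuclideanSpace ℝ (Fin n)

/-- Real `N × n` matrices with the Euclidean (Frobenius) inner product and norm; the entry in row
`i` and column `j` of `z` is `z (i, j)`. -/
abbrev Mat (N n : ℕ) : Type := EuclideanSpace ℝ (Fin N × Fin n)

/-- Lebesgue measure on `Ω`. -/
abbrev leb {n : ℕ} (Ω : Set (Vec n)) : Measure (Vec n) := (volume : Measure (Vec n)).restrict Ω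

/-- `G` is the weak gradient of `u` on `Ω`: `∫_Ω uᵢ ∂ⱼφ dx = - ∫_Ω G_{ij} φ dx` for all test
functions `φ ∈ C_c^∞(Ω)` and all `i`, `j`. -/
def IsWeakGradient {N n : ℕ} (Ω : Set (Vec n)) (u : Vec n → Vec N) (G : Vec n → Mat N n) : Prop :=
  ∀ φ : Vec n → ℝ, ContDiff ℝ ∞ φ → HasCompactSupport φ → tsupport φ ⊆ Ω →
    ∀ (i : Fin N) (j : Fin n),
      ∫ x, u x i * fderiv ℝ φ x (EuclideanSpace.single j 1) ∂(leb Ω)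
        = - ∫ x, G x (i, j) * φ x ∂(leb Ω)

/-- The Sobolev space `W^{1,1}(Ω; ℝ^N)`: a function of class `L¹` together with its weak gradient,
which is also of class `L¹` (and which is determined by the function when `Ω` is open). -/
structure W11 {n : ℕ} (N : ℕ) (Ω : Set (Vec n)) where
  /-- the function -/
  val : Lp (Vec N) 1 (leb Ω)
  /-- its weak gradient `∇w` -/
  grad : Lp (Mat N n) 1 (leb Ω)
  isWeakGradient : IsWeakGradient Ω val grad

/-- Linear growth: `ν |z| - L ≤ F(z) ≤ L (1 + |z|)` for some constants `0 < ν ≤ L`. -/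
def HasLinearGrowth {N n : ℕ} (F : Mat N n → ℝ) : Prop :=
  ∃ ν L : ℝ, 0 < ν ∧ ν ≤ L ∧ ∀ z, ν * ‖z‖ - L ≤ F z ∧ F z ≤ L * (1 + ‖z‖)

/-- The recession function `F^∞(z) = lim_{t ↘ 0} t F(z / t)`; the limit exists for every convex
function `F` of linear growth. -/
def recession {N n : ℕ} (F : Mat N n → ℝ) (z : Mat N n) : ℝ :=
  limUnder (𝓝[>] (0 : ℝ)) (fun t : ℝ => t * F (t⁻¹ • z))

/-- The strict coercivity condition
`ess inf_{x ∈ Ω} min_{|ξ| = 1} (F^∞(ξ) - T₀(x) · ξ) > 0`. -/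
def StrictlyCoercive {N n : ℕ} (Ω : Set (Vec n)) (F : Mat N n → ℝ) (T₀ : Vec n → Mat N n) : Prop :=
  0 < essInf (fun x => ⨅ ξ : Metric.sphere (0 : Mat N n) 1,
      ((recession F ξ - inner ℝ (T₀ x) (ξ : Mat N n) : ℝ) : EReal)) (leb Ω)

/-- The primal functional `ℱ[w] = ∫_Ω (F(∇w) - T₀ · ∇w) dx` on `W^{1,1}(Ω; ℝ^N)`. -/
def primal {N n : ℕ} {Ω : Set (Vec n)} (F : Mat N n → ℝ) (T₀ : Vec n → Mat N n)
    (w : W11 N Ω) : ℝ :=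
  ∫ x, (F (w.grad x) - inner ℝ (T₀ x) (w.grad x)) ∂(leb Ω)

/-- The infimum of the primal functional over `W^{1,1}(Ω; ℝ^N)`, as an extended real number. -/
def primalInf {N n : ℕ} (Ω : Set (Vec n)) (F : Mat N n → ℝ) (T₀ : Vec n → Mat N n) : EReal :=
  ⨅ w : W11 N Ω, (primal F T₀ w : EReal)

/-- `(u_k)` is a minimising sequence of the primal problem. -/
def IsMinimisingSeq {N n : ℕ} {Ω : Set (Vec n)} (F : Mat N n → ℝ) (T₀ : Vec n → Mat N n)
    (u : ℕ → W11 N Ω) : Prop :=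
  Tendsto (fun k => (primal F T₀ (u k) : EReal)) atTop (𝓝 (primalInf Ω F T₀))

/-- The conjugate function `F^*(z^*) = sup_z (z^* · z - F(z))`, with values in `ℝ ∪ {∞}`. -/
def conjugate {N n : ℕ} (F : Mat N n → ℝ) (zs : Mat N n) : EReal :=
  ⨆ z : Mat N n, ((inner ℝ zs z - F z : ℝ) : EReal)

/-- The Lebesgue integral `∫ g⁺ dμ - ∫ g⁻ dμ` of an extended real valued function `g`. It is the
usual one whenever one of the two terms is finite, for instance when `g` is bounded from below and
`μ` is finite. -/
def erealIntegral {α : Type*} [MeasurableSpace α] (μ : Measure α) (g : α → EReal) : EReal :=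
  ((∫⁻ x, (g x).toENNReal ∂μ : ℝ≥0∞) : EReal) - ((∫⁻ x, (-(g x)).toENNReal ∂μ : ℝ≥0∞) : EReal)

/-- The space `L^∞_⊥(Ω; ℝ^{N × n})` of all `χ ∈ L^∞` with `∫_Ω χ · ∇w dx = 0` for all
`w ∈ W^{1,1}(Ω; ℝ^N)`. -/
def LinftyPerp {n : ℕ} (N : ℕ) (Ω : Set (Vec n)) : Set (Lp (Mat N n) ∞ (leb Ω)) :=
  {χ | ∀ w : W11 N Ω, ∫ x, inner ℝ (χ x) (w.grad x) ∂(leb Ω) = 0}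

/-- The dual functional `ℛ_{T₀}[χ] = - ∫_Ω F^*(T₀ + χ) dx`, with values in `ℝ ∪ {-∞}`. -/
def dual {N n : ℕ} (Ω : Set (Vec n)) (F : Mat N n → ℝ) (T₀ χ : Vec n → Mat N n) : EReal :=
  - erealIntegral (leb Ω) (fun x => conjugate F (T₀ x + χ x))

/-- The supremum of the dual functional over `L^∞_⊥(Ω; ℝ^{N × n})`. -/
def dualSup {N n : ℕ} (Ω : Set (Vec n)) (F : Mat N n → ℝ) (T₀ : Vec n → Mat N n) : EReal :=
  ⨆ χ ∈ LinftyPerp N Ω, dual Ω F T₀ χ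

/-- `σ` is a maximiser of the dual problem. -/
def IsDualMaximiser {N n : ℕ} {Ω : Set (Vec n)} (F : Mat N n → ℝ) (T₀ : Vec n → Mat N n)
    (σ : Lp (Mat N n) ∞ (leb Ω)) : Prop :=
  σ ∈ LinftyPerp N Ω ∧ ∀ χ ∈ LinftyPerp N Ω, dual Ω F T₀ χ ≤ dual Ω F T₀ σ

/-- The functions `s k` belong to `L^∞(Ω; ℝ^{N × n})` and converge there to `σ` in the weak-*
sense, that is, against every `g ∈ L¹(Ω; ℝ^{N × n})`. -/
def TendstoWeakStar {N n : ℕ} {Ω : Set (Vec n)} (s : ℕ → Vec n → Mat N n)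
    (σ : Lp (Mat N n) ∞ (leb Ω)) : Prop :=
  (∀ k, MemLp (s k) ∞ (leb Ω)) ∧
    ∀ g : Lp (Mat N n) 1 (leb Ω),
      Tendsto (fun k => ∫ x, inner ℝ (s k x) (g x) ∂(leb Ω)) atTop
        (𝓝 (∫ x, inner ℝ (σ x) (g x) ∂(leb Ω)))

end NeumannDuality

end

/-! Everything rests on the Fenchel gap F(∇w) + F*(T₀ + χ) - (T₀ + χ)·∇w. It is nonnegative, and
since χ annihilates gradients its integral is the primal value at w minus the dual value at χ. This
is weak duality (`dual_le_primal`).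

Strong duality, with attainment, is Hahn-Banach in L¹. The functional g ↦ ∫ (F(g) - T₀·g) is convex
and Lipschitz on L¹ and is at least m, the primal infimum, on the subspace of gradients. Separating
its strict epigraph from that subspace at height m gives l in (L¹)* that vanishes on gradients and
keeps the functional above m + l everywhere (`ConvexOn.exists_dual_eq_zero_on_submodule`). Represent
l by χ in L^∞ (`exists_Linfty_repr`); exchanging supremum and integral
(`exists_integrable_conjugate`) shows that χ has dual value at least m.

Now let χ be any maximiser and u_k any minimising sequence. The gaps tend to 0 in L¹, hence almost
everywhere along a subsequence. A zero gap at z means that z minimises F - q·z with q = T₀ + χ, so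
DF(z) = q; by compactness, a small gap at bounded z makes DF(z) close to q. Strict coercivity bounds
∇u_k in L¹, so |∇u_k| is large only on small sets, and DF(∇u_k) → q in measure. As DF is bounded,
dominated convergence gives the weak-* limit. Every maximiser is therefore the limit of one and the
same sequence, which proves uniqueness without any strict convexity of F*. -/

/-! ### Gradients of convex functions of linear growth -/

section ConvexAnalysis

variable {E : Type*} [NormedAddCommGroup E] [InnerProductSpace ℝ E] [FiniteDimensional ℝ E]
  {F : E → ℝ}

/-- The gradient of a differentiable convex function is a subgradient. -/
theorem ConvexOn.add_inner_gradient_le (hc : ConvexOn ℝ Set.univ F) (hd : Differentiable ℝ F)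
    (z y : E) : F z + inner ℝ (gradient F z) (y - z) ≤ F y := by
  have hconv : ConvexOn ℝ Set.univ (fun t : ℝ => F (z + t • (y - z))) := by
    have h := hc.comp_affineMap (AffineMap.lineMap z y : ℝ →ᵃ[ℝ] E)
    refine h.congr ?_
    intro t _
    simp [AffineMap.lineMap_apply, add_comm]
  have hder : HasDerivAt (fun t : ℝ => F (z + t • (y - z)))
      (inner ℝ (gradient F z) (y - z)) 0 := by
    have h1 : HasDerivAt (fun t : ℝ => z + t • (y - z)) (y - z) 0 := by
      simpa using ((hasDerivAt_id (0 : ℝ)).smul_const (y - z)).const_add z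
    have h2 : HasFDerivAt F (InnerProductSpace.toDual ℝ E (gradient F z))
        (z + (0 : ℝ) • (y - z)) := by
      simpa using (hd z).hasGradientAt.hasFDerivAt
    exact h2.comp_hasDerivAt (0 : ℝ) h1
  have h := hconv.le_slope_of_hasDerivAt (Set.mem_univ 0) (Set.mem_univ 1) one_pos hder
  simp only [slope_def_field, one_smul, zero_smul, add_zero, sub_zero, div_one,
    add_sub_cancel] at h
  linarith

theorem continuous_gradient (hF : ContDiff ℝ 1 F) : Continuous (gradient F) :=
  (InnerProductSpace.toDual ℝ E).symm.continuous.comp (hF.continuous_fderiv one_ne_zero)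

/-- The gradient of a convex function of linear growth is bounded. -/
theorem ConvexOn.norm_gradient_le (hc : ConvexOn ℝ Set.univ F) (hd : Differentiable ℝ F) {L : ℝ}
    (hL : 0 ≤ L) (hg : ∀ z, F z ≤ L * (1 + ‖z‖)) (z : E) : ‖gradient F z‖ ≤ L := by
  set p := gradient F z with hp
  by_contra! hlt
  have hc0 : 0 ≤ L + L * ‖z‖ - F z := by linarith [hg z]
  -- Along the ray z + t p the subgradient inequality gives slope at least ‖p‖², while linear growth
  -- allows only L‖p‖; a large t is then contradictory if ‖p‖ > L.
  have key (t : ℝ) (ht : 0 ≤ t) : t * (‖p‖ * (‖p‖ - L)) ≤ L + L * ‖z‖ - F z := by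
    have h1 := hc.add_inner_gradient_le hd z (z + t • p)
    have h2 := hg (z + t • p)
    have h3 : ‖z + t • p‖ ≤ ‖z‖ + t * ‖p‖ := by
      simpa [norm_smul, abs_of_nonneg ht] using norm_add_le z (t • p)
    rw [add_sub_cancel_left, inner_smul_right, ← hp, real_inner_self_eq_norm_sq] at h1
    nlinarith
  have hpos : 0 < ‖p‖ * (‖p‖ - L) := mul_pos (hL.trans_lt hlt) (by linarith)
  have h := key ((L + L * ‖z‖ - F z + 1) / (‖p‖ * (‖p‖ - L))) (by positivity)
  rw [div_mul_cancel₀ _ hpos.ne'] at h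
  linarith

theorem ConvexOn.abs_sub_le_of_linear_growth (hc : ConvexOn ℝ Set.univ F)
    (hd : Differentiable ℝ F) {L : ℝ} (hL : 0 ≤ L) (hg : ∀ z, F z ≤ L * (1 + ‖z‖)) (y z : E) :
    |F y - F z| ≤ L * ‖y - z‖ := by
  have aux (a b : E) : F a - F b ≤ L * ‖a - b‖ := by
    have h1 := hc.add_inner_gradient_le hd a b
    have h2 := real_inner_le_norm (gradient F a) (a - b)
    have h3 := mul_le_mul_of_nonneg_right (hc.norm_gradient_le hd hL hg a) (norm_nonneg (a - b))
    rw [← neg_sub a b, inner_neg_right] at h1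
    linarith
  rw [abs_le]
  constructor
  · have := aux z y
    rw [norm_sub_rev] at this
    linarith
  · exact aux y z

/-- On bounded sets, a small gap in the Fenchel inequality `⟪q, z⟫ ≤ F z + c` forces the gradient
of `F` to be close to `q`. -/
theorem exists_norm_gradient_sub_lt (hF : ContDiff ℝ 1 F) {q : E} {c : ℝ}
    (hq : ∀ z, inner ℝ q z - F z ≤ c) (M : ℝ) {ε : ℝ} (hε : 0 < ε) :
    ∃ η > 0, ∀ z, ‖z‖ ≤ M → F z + c - inner ℝ q z < η → ‖gradient F z - q‖ < ε := by
  have hd : Differentiable ℝ F := hF.differentiable one_ne_zero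
  have hs : Continuous fun z => F z + c - inner ℝ q z := by
    have := hF.continuous
    fun_prop
  have hn : Continuous fun z => ‖gradient F z - q‖ :=
    ((continuous_gradient hF).sub continuous_const).norm
  set K : Set E := Metric.closedBall 0 M ∩ {z | ε ≤ ‖gradient F z - q‖} with hK
  have hKc : IsCompact K :=
    (isCompact_closedBall _ _).inter_right (isClosed_le continuous_const hn)
  -- At a point with zero gap, F - ⟪q, ·⟫ attains its minimum, so the gradient there equals q, which
  -- is excluded on K.
  have hpos : ∀ z ∈ K, 0 < F z + c - inner ℝ q z := by
    intro z hz
    refine lt_of_le_of_ne (by linarith [hq z]) fun h0 => ?_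
    have hmin : IsLocalMin (fun y => F y - inner ℝ q y) z :=
      Eventually.of_forall fun y => by
        have := hq y
        show F z - inner ℝ q z ≤ F y - inner ℝ q y
        linarith
    have h1 := hmin.fderiv_eq_zero
    have h2 : HasFDerivAt (fun y => F y - inner ℝ q y)
        (InnerProductSpace.toDual ℝ E (gradient F z) - InnerProductSpace.toDual ℝ E q) z :=
      (hd z).hasGradientAt.hasFDerivAt.sub (InnerProductSpace.toDual ℝ E q).hasFDerivAt
    rw [h2.fderiv, ← map_sub] at h1
    have h3 : gradient F z - q = 0 := (InnerProductSpace.toDual ℝ E).map_eq_zero_iff.1 h1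
    have h4 : ε ≤ ‖gradient F z - q‖ := hz.2
    rw [h3, norm_zero] at h4
    linarith
  rcases K.eq_empty_or_nonempty with hE | hne
  · refine ⟨1, one_pos, fun z hz _ => ?_⟩
    by_contra! h
    exact (Set.eq_empty_iff_forall_notMem.1 hE z) ⟨by simpa using hz, h⟩
  · obtain ⟨z₀, hz₀, hmin⟩ := hKc.exists_isMinOn hne hs.continuousOn
    refine ⟨_, hpos z₀ hz₀, fun z hz hlt => ?_⟩
    by_contra! h
    exact absurd (hmin (show z ∈ K from ⟨by simpa using hz, h⟩)) (not_le.2 hlt)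

/-- If the gap in the Fenchel inequality tends to zero along a sequence, then the gradient tends to
`q`, up to a weight that becomes large only where the sequence is unbounded. -/
theorem tendsto_norm_gradient_sub_div (hF : ContDiff ℝ 1 F) {q : E} {c : ℝ}
    (hq : ∀ z, inner ℝ q z - F z ≤ c) {C : ℝ} (hC : ∀ z, ‖gradient F z - q‖ ≤ C) {z : ℕ → E}
    (hz : Tendsto (fun k => F (z k) + c - inner ℝ q (z k)) atTop (𝓝 0)) :
    Tendsto (fun k => ‖gradient F (z k) - q‖ / (1 + ‖z k‖)) atTop (𝓝 0) := by
  have hC0 : 0 ≤ C := (norm_nonneg _).trans (hC 0)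
  rw [Metric.tendsto_atTop]
  intro ε hε
  -- Beyond radius C / ε the weight alone suffices, since C < ε‖z‖; compactness is needed only
  -- inside that ball.
  obtain ⟨η, hη, h⟩ := exists_norm_gradient_sub_lt hF hq (C / ε) hε
  obtain ⟨k₀, hk₀⟩ := (Metric.tendsto_atTop.1 hz) η hη
  refine ⟨k₀, fun k hk => ?_⟩
  have h1 : F (z k) + c - inner ℝ q (z k) < η := by
    have := hk₀ k hk
    rw [Real.dist_0_eq_abs] at this
    exact (le_abs_self _).trans_lt this
  have hp : 0 < 1 + ‖z k‖ := by positivity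
  rw [Real.dist_0_eq_abs, abs_of_nonneg (by positivity), div_lt_iff₀ hp]
  by_cases hM : ‖z k‖ ≤ C / ε
  · have := h _ hM h1
    nlinarith [norm_nonneg (z k)]
  · rw [not_le, div_lt_iff₀ hε] at hM
    nlinarith [hC (z k)]

end ConvexAnalysis

namespace NeumannDuality

/-! ### The recession function and coercivity -/

section Recession

variable {N n : ℕ} {F : Mat N n → ℝ}

/-- Convexity on the segment from 0 to t • ξ. Monotonicity provides both the existence of the
recession limit and the hypothesis of Dini's theorem. -/
theorem monotoneOn_slope_zero (hc : ConvexOn ℝ Set.univ F) (ξ : Mat N n) :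
    MonotoneOn (fun s : ℝ => (F (s • ξ) - F 0) / s) (Set.Ioi 0) := by
  intro s hs t ht hst
  have hs : 0 < s := hs
  have ht : 0 < t := ht
  have h := hc.2 (Set.mem_univ (t • ξ)) (Set.mem_univ 0) 
    (show 0 ≤ s / t by positivity)
    (show 0 ≤ 1 - s / t by rw [sub_nonneg, div_le_one ht]; exact hst) (by ring)
  rw [smul_zero, add_zero, smul_smul, div_mul_cancel₀ _ ht.ne'] at h
  simp only [smul_eq_mul] at h
  show (F (s • ξ) - F 0) / s ≤ (F (t • ξ) - F 0) / t
  rw [div_le_iff₀ hs]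
  calc F (s • ξ) - F 0 ≤ s / t * (F (t • ξ) - F 0) := by linarith
    _ = (F (t • ξ) - F 0) / t * s := by ring

/-- The recession function is the limit of the difference quotients at `0`. -/
theorem tendsto_slope_recession (hc : ConvexOn ℝ Set.univ F) (hd : Differentiable ℝ F) {L : ℝ}
    (hL : 0 ≤ L) (hg : ∀ z, F z ≤ L * (1 + ‖z‖)) (ξ : Mat N n) :
    Tendsto (fun s : ℝ => (F (s • ξ) - F 0) / s) atTop (𝓝 (recession F ξ)) := by
  set r : ℝ → ℝ := fun s => (F (s • ξ) - F 0) / s with hr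
  obtain ⟨l, hl⟩ : ∃ l, Tendsto r atTop (𝓝 l) := by
    -- Freezing the quotient below 1 makes it monotone on all of ℝ without changing its limit at
    -- infinity.
    have hmono : Monotone fun s => r (max s 1) := fun s t hst =>
      monotoneOn_slope_zero hc ξ (lt_max_of_lt_right one_pos : (0 : ℝ) < max s 1)
        (lt_max_of_lt_right one_pos : (0 : ℝ) < max t 1) (max_le_max_right 1 hst)
    have hbdd : BddAbove (Set.range fun s => r (max s 1)) := by
      refine ⟨L * ‖ξ‖, ?_⟩
      rintro _ ⟨s, rfl⟩
      have hs : 0 < max s 1 := lt_max_of_lt_right one_pos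
      have h := (le_abs_self _).trans (hc.abs_sub_le_of_linear_growth hd hL hg (max s 1 • ξ) 0)
      show (F (max s 1 • ξ) - F 0) / max s 1 ≤ _
      rw [div_le_iff₀ hs]
      rw [sub_zero, norm_smul, Real.norm_of_nonneg hs.le] at h
      linarith
    refine ⟨_, (tendsto_atTop_ciSup hmono hbdd).congr' ?_⟩
    filter_upwards [eventually_ge_atTop 1] with s hs
    rw [max_eq_left hs]
  have h1 : Tendsto (fun t : ℝ => t * F (t⁻¹ • ξ)) (𝓝[>] (0 : ℝ)) (𝓝 l) := by
    have h2 : Tendsto (fun t : ℝ => r t⁻¹ + t * F 0) (𝓝[>] (0 : ℝ)) (𝓝 (l + 0 * F 0)) :=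
      (hl.comp tendsto_inv_nhdsGT_zero).add
        ((tendsto_nhdsWithin_of_tendsto_nhds tendsto_id).mul_const _)
    rw [zero_mul, add_zero] at h2
    refine h2.congr' ?_
    filter_upwards [self_mem_nhdsWithin] with t ht
    have ht : (0 : ℝ) < t := ht
    simp only [hr, div_inv_eq_mul]
    ring
  have h3 : recession F ξ = l := h1.limUnder_eq
  rw [h3]
  exact hl

theorem continuous_recession (hc : ConvexOn ℝ Set.univ F) (hd : Differentiable ℝ F) {L : ℝ}
    (hL : 0 ≤ L) (hg : ∀ z, F z ≤ L * (1 + ‖z‖)) : Continuous (recession F) := by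
  refine (LipschitzWith.of_dist_le_mul (K := L.toNNReal) fun ξ ζ => ?_).continuous
  rw [Real.coe_toNNReal _ hL, Real.dist_eq, dist_eq_norm]
  refine le_of_tendsto ((tendsto_slope_recession hc hd hL hg ξ).sub
    (tendsto_slope_recession hc hd hL hg ζ)).abs ?_
  filter_upwards [eventually_gt_atTop 0] with s hs
  have h := hc.abs_sub_le_of_linear_growth hd hL hg (s • ξ) (s • ζ)
  rw [← smul_sub, norm_smul, Real.norm_of_nonneg hs.le] at h
  rw [← sub_div, abs_div, abs_of_pos hs, div_le_iff₀ hs, sub_sub_sub_cancel_right]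
  linarith

/-- A convex function of linear growth is bounded below by its recession function, up to an
arbitrarily small linear error and a constant. -/
theorem exists_recession_sub_mul_norm_le (hc : ConvexOn ℝ Set.univ F) (hd : Differentiable ℝ F)
    {L : ℝ} (hL : 0 ≤ L) (hg : ∀ z, F z ≤ L * (1 + ‖z‖)) {δ : ℝ} (hδ : 0 < δ) :
    ∃ s > 0, ∀ z : Mat N n, s ≤ ‖z‖ →
      F 0 + (recession F (‖z‖⁻¹ • z) - δ) * ‖z‖ ≤ F z := by
  -- Dini's theorem on the compact unit sphere: continuous quotients increase pointwise to a
  -- continuous limit.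
  have hunif : TendstoUniformlyOn
      (fun (k : ℕ) (ξ : Mat N n) => (F (((k : ℝ) + 1) • ξ) - F 0) / ((k : ℝ) + 1))
      (recession F) atTop (Metric.sphere 0 1) := by
    refine Monotone.tendstoUniformlyOn_of_forall_tendsto (isCompact_sphere 0 1) ?_ ?_
      (continuous_recession hc hd hL hg).continuousOn ?_
    · intro k
      have := hd.continuous
      exact Continuous.continuousOn (by fun_prop)
    · intro ξ _ k l hkl
      have : (k : ℝ) ≤ l := by exact_mod_cast hkl
      exact monotoneOn_slope_zero hc ξ (by positivity : (0 : ℝ) < (k : ℝ) + 1)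
        (by positivity : (0 : ℝ) < (l : ℝ) + 1) (by linarith)
    · intro ξ _
      exact (tendsto_slope_recession hc hd hL hg ξ).comp
        (tendsto_atTop_add_const_right _ _ tendsto_natCast_atTop_atTop)
  obtain ⟨k, hk⟩ := (Metric.tendstoUniformlyOn_iff.1 hunif δ hδ).exists
  have hk0 : (0 : ℝ) < (k : ℝ) + 1 := by positivity
  refine ⟨(k : ℝ) + 1, hk0, fun z hz => ?_⟩
  have hz0 : 0 < ‖z‖ := hk0.trans_le hz
  set ξ := ‖z‖⁻¹ • z with hξ
  have hξ1 : ξ ∈ Metric.sphere (0 : Mat N n) 1 := by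
    simp [hξ, norm_smul, hz0.ne']
  have hzξ : ‖z‖ • ξ = z := by simp [hξ, smul_smul, hz0.ne']
  have h1 := hk ξ hξ1
  rw [Real.dist_eq] at h1
  have h2 := monotoneOn_slope_zero hc ξ (Set.mem_Ioi.2 hk0) (Set.mem_Ioi.2 hz0) hz
  simp only [hzξ] at h2
  have h3 : recession F ξ - δ ≤ (F z - F 0) / ‖z‖ := by
    linarith [le_abs_self (recession F ξ - (F (((k : ℝ) + 1) • ξ) - F 0) / ((k : ℝ) + 1))]
  rw [le_div_iff₀ hz0] at h3
  linarith

/-- The strict coercivity condition yields a lower bound of linear growth for the integrand of the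
primal functional. -/
theorem StrictlyCoercive.exists_le {Ω : Set (Vec n)} (hc : ConvexOn ℝ Set.univ F)
    (hd : Differentiable ℝ F) (hg : HasLinearGrowth F) {T : Vec n → Mat N n} {B : ℝ}
    (hB : ∀ᵐ x ∂leb Ω, ‖T x‖ ≤ B) (hT : StrictlyCoercive Ω F T) :
    ∃ c > 0, ∃ C, ∀ᵐ x ∂leb Ω, ∀ z, c * ‖z‖ - C ≤ F z - inner ℝ (T x) z := by
  obtain ⟨ν, L, hν, hνL, hgr⟩ := hg
  have hL : 0 ≤ L := hν.le.trans hνL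
  obtain ⟨δ, hδ0, hδ⟩ := EReal.lt_iff_exists_real_btwn.1 hT
  have hδ0 : 0 < δ := by exact_mod_cast hδ0
  obtain ⟨s, hs, hrec⟩ := exists_recession_sub_mul_norm_le hc hd hL (fun z => (hgr z).2)
    (half_pos hδ0)
  -- For ‖z‖ ≥ s, half of the margin δ pays for the error in the recession bound and half remains.
  -- For ‖z‖ < s everything is bounded, and the second entry of the maximum absorbs it.
  refine ⟨δ / 2, half_pos hδ0, max (-F 0) (L + |B| * s + δ / 2 * s), ?_⟩
  filter_upwards [ae_lt_of_lt_essInf hδ, hB] with x hx hxB z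
  by_cases hz : s ≤ ‖z‖
  · have hz0 : 0 < ‖z‖ := hs.trans_le hz
    have h1 := hrec z hz
    have h2 : δ ≤ recession F (‖z‖⁻¹ • z) - inner ℝ (T x) (‖z‖⁻¹ • z) := by
      have := hx.le.trans (iInf_le _ ⟨‖z‖⁻¹ • z, by simp [norm_smul, hz0.ne']⟩)
      exact_mod_cast this
    have h3 : inner ℝ (T x) (‖z‖⁻¹ • z) * ‖z‖ = inner ℝ (T x) z := by
      rw [inner_smul_right]
      field_simp
    have h4 := mul_le_mul_of_nonneg_right h2 hz0.le
    rw [sub_mul, h3] at h4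
    linarith [le_max_left (-F 0) (L + |B| * s + δ / 2 * s)]
  · rw [not_le] at hz
    have h1 := (hgr z).1
    have h2 : inner ℝ (T x) z ≤ |B| * s :=
      (real_inner_le_norm _ _).trans (mul_le_mul (hxB.trans (le_abs_self B)) hz.le
        (norm_nonneg z) (abs_nonneg B))
    have h3 := le_max_right (-F 0) (L + |B| * s + δ / 2 * s)
    nlinarith [norm_nonneg z]

end Recession

end NeumannDuality

/-! ### The dual of L¹ on a finite measure space -/

section DualOfL1

theorem MeasureTheory.Integrable.inner_of_bound {α E : Type*} [MeasurableSpace α] {μ : Measure α}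
    [NormedAddCommGroup E] [InnerProductSpace ℝ E] {f g : α → E} {C : ℝ}
    (hf : AEStronglyMeasurable f μ) (hC : ∀ᵐ x ∂μ, ‖f x‖ ≤ C) (hg : Integrable g μ) :
    Integrable (fun x => inner ℝ (f x) (g x)) μ := by
  refine (hg.norm.const_mul C).mono' (hf.inner hg.1) ?_
  filter_upwards [hC] with x hx
  exact (norm_inner_le_norm _ _).trans (mul_le_mul_of_nonneg_right hx (norm_nonneg _))

theorem MeasureTheory.Lp.exists_ae_norm_le {α E : Type*} [MeasurableSpace α] {μ : Measure α}
    [NormedAddCommGroup E] (χ : Lp E ∞ μ) : ∃ C, ∀ᵐ x ∂μ, ‖χ x‖ ≤ C :=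
  ⟨_, by
    filter_upwards [ae_le_eLpNormEssSup (f := χ) (μ := μ)] with x hx
    rw [← eLpNorm_exponent_top] at hx
    exact (ENNReal.toReal_mono (Lp.eLpNorm_ne_top χ) hx)⟩

variable {α E : Type*} [MeasurableSpace α] {μ : Measure α} [IsFiniteMeasure μ]
  [NormedAddCommGroup E] [InnerProductSpace ℝ E] [CompleteSpace E]

/-- Continuous linear functionals on `L¹` of a finite measure are represented by elements
of `L^∞`. -/
theorem exists_Linfty_repr (l : StrongDual ℝ (Lp E 1 μ)) :
    ∃ χ : Lp E ∞ μ, ∀ g : Lp E 1 μ, l g = ∫ x, inner ℝ (χ x) (g x) ∂μ := by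
  have hmem (g : Lp E 2 μ) : MemLp g 1 μ := (Lp.memLp g).mono_exponent (by norm_num)
  have hle : ∃ K : ℝ, ∀ g : Lp E 2 μ, ‖(hmem g).toLp g‖ ≤ K * ‖g‖ := by
    refine ⟨((μ Set.univ) ^ (1 / (1 : ℝ≥0∞).toReal - 1 / (2 : ℝ≥0∞).toReal)).toReal,
      fun g => ?_⟩
    rw [Lp.norm_toLp, Lp.norm_def, ← ENNReal.toReal_mul, mul_comm]
    refine ENNReal.toReal_mono (ENNReal.mul_ne_top (Lp.eLpNorm_ne_top g) ?_)
      (eLpNorm_le_eLpNorm_mul_rpow_measure_univ (by norm_num) (Lp.memLp g).1)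
    exact ENNReal.rpow_ne_top_of_nonneg (by norm_num) (measure_ne_top _ _)
  obtain ⟨K, hK⟩ := hle
  let ι : Lp E 2 μ →L[ℝ] Lp E 1 μ := LinearMap.mkContinuous
    { toFun := fun g => (hmem g).toLp g
      map_add' := fun f g => by
        rw [← MemLp.toLp_add]
        exact MemLp.toLp_congr _ _ (Lp.coeFn_add f g)
      map_smul' := fun c g => by
        rw [RingHom.id_apply, ← MemLp.toLp_const_smul]
        exact MemLp.toLp_congr _ _ (Lp.coeFn_smul c g) } K hK
  -- On a finite measure L² embeds continuously in L¹, so the restriction of l to L² has a Riesz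
  -- representative.
  set h : Lp E 2 μ := (InnerProductSpace.toDual ℝ (Lp E 2 μ)).symm (l.comp ι) with hh
  have hrep (g : Lp E 2 μ) : l ((hmem g).toLp g) = ∫ x, inner ℝ (h x) (g x) ∂μ := by
    rw [← L2.inner_def, hh, InnerProductSpace.toDual_symm_apply]
    rfl
  -- Testing with h on the set A where ‖h‖ > ‖l‖ gives ∫_A ‖h‖² ≤ ‖l‖ ∫_A ‖h‖, which forces A to be
  -- null.
  have hbound : ∀ᵐ x ∂μ, ‖h x‖ ≤ ‖l‖ := by
    have hsm : StronglyMeasurable h := Lp.stronglyMeasurable h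
    set A : Set α := {x | ‖l‖ < ‖h x‖} with hA
    have hAm : MeasurableSet A := measurableSet_lt measurable_const hsm.norm.measurable
    have hind : MemLp (A.indicator h) 2 μ := (Lp.memLp h).indicator hAm
    have h1 := hrep (hind.toLp _)
    have h2 : ∫ x, inner ℝ (h x) ((hind.toLp _ : Lp E 2 μ) x) ∂μ
        = ∫ x in A, ‖h x‖ ^ 2 ∂μ := by
      rw [← integral_indicator hAm]
      refine integral_congr_ae ?_
      filter_upwards [hind.coeFn_toLp] with x hx
      rw [hx]
      by_cases hxA : x ∈ A <;> simp [hxA]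
    have hind1 : MemLp (A.indicator h) 1 μ := hind.mono_exponent (by norm_num)
    have h3 : (hmem (hind.toLp _)).toLp (hind.toLp _ : Lp E 2 μ) = hind1.toLp _ :=
      MemLp.toLp_congr _ _ hind.coeFn_toLp
    have h4 : ‖hind1.toLp _‖ = ∫ x in A, ‖h x‖ ∂μ := by
      rw [L1.norm_eq_integral_norm, ← integral_indicator hAm]
      refine integral_congr_ae ?_
      filter_upwards [hind1.coeFn_toLp] with x hx
      rw [hx, Set.indicator_apply, Set.indicator_apply]
      split_ifs <;> simp
    have h5 : ∫ x in A, ‖h x‖ ^ 2 ∂μ ≤ ‖l‖ * ∫ x in A, ‖h x‖ ∂μ := by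
      rw [← h2, ← h1, ← h4, h3]
      exact (le_abs_self _).trans (l.le_opNorm _)
    have hi1 : Integrable (fun x => ‖h x‖) μ := (memLp_one_iff_integrable.1 (hmem h)).norm
    have hi2 : Integrable (fun x => ‖h x‖ ^ 2) μ := (Lp.memLp h).integrable_norm_pow (by norm_num)
    have h6 : ∫ x in A, ‖h x‖ * (‖h x‖ - ‖l‖) ∂μ ≤ 0 := by
      have : ∀ x, ‖h x‖ * (‖h x‖ - ‖l‖) = ‖h x‖ ^ 2 - ‖l‖ * ‖h x‖ := fun x => by ring
      simp_rw [this]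
      rw [integral_sub hi2.integrableOn (hi1.const_mul _).integrableOn, integral_const_mul]
      linarith
    have hpos : ∀ x ∈ A, 0 < ‖h x‖ * (‖h x‖ - ‖l‖) := fun x hx =>
      mul_pos ((norm_nonneg l).trans_lt hx) (sub_pos.2 hx)
    have hint : IntegrableOn (fun x => ‖h x‖ * (‖h x‖ - ‖l‖)) A μ := by
      have : (fun x => ‖h x‖ * (‖h x‖ - ‖l‖)) = fun x => ‖h x‖ ^ 2 - ‖l‖ * ‖h x‖ := by
        ext x; ring
      rw [this]
      exact (hi2.sub (hi1.const_mul _)).integrableOn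
    have hnull : μ A = 0 := by
      by_contra hne
      refine absurd h6 (not_le.2 ?_)
      rw [setIntegral_pos_iff_support_of_nonneg_ae ?_ hint]
      · refine (pos_iff_ne_zero.2 hne).trans_le (measure_mono fun x hx => ⟨?_, hx⟩)
        exact (hpos x hx).ne'
      · exact (ae_restrict_iff' hAm).2 (Eventually.of_forall fun x hx => (hpos x hx).le)
    filter_upwards [measure_eq_zero_iff_ae_notMem.1 hnull] with x hx
    exact not_lt.1 hx
  have hχ : MemLp h ∞ μ := memLp_top_of_bound (Lp.memLp h).1 _ hbound
  refine ⟨hχ.toLp _, fun g => ?_⟩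
  have hcongr (g : Lp E 1 μ) : ∫ x, inner ℝ ((hχ.toLp h : Lp E ∞ μ) x) (g x) ∂μ
      = ∫ x, inner ℝ (h x) (g x) ∂μ := by
    refine integral_congr_ae ?_
    filter_upwards [hχ.coeFn_toLp] with x hx
    rw [hx]
  rw [hcongr]
  have hint (f : α → E) (hf : Integrable f μ) : Integrable (fun x => inner ℝ (h x) (f x)) μ :=
    Integrable.inner_of_bound (Lp.memLp h).1 hbound hf
  have hcont : Continuous fun g : Lp E 1 μ => ∫ x, inner ℝ (h x) (g x) ∂μ := by
    refine (LipschitzWith.of_dist_le_mul (K := ‖l‖₊) fun f g => ?_).continuous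
    rw [Real.dist_eq, dist_eq_norm, L1.norm_eq_integral_norm, coe_nnnorm,
      ← integral_sub (hint f (L1.integrable_coeFn f)) (hint g (L1.integrable_coeFn g)),
      ← integral_const_mul]
    refine (abs_integral_le_integral_abs).trans (integral_mono_ae
      ((hint f (L1.integrable_coeFn f)).sub (hint g (L1.integrable_coeFn g))).abs
      ((L1.integrable_coeFn (f - g)).norm.const_mul _) ?_)
    filter_upwards [hbound, Lp.coeFn_sub f g] with x hx hs
    rw [hs, ← inner_sub_right]
    exact (abs_real_inner_le_norm _ _).trans (mul_le_mul_of_nonneg_right hx (norm_nonneg _))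
  induction g using Lp.induction ENNReal.one_ne_top with
  | indicatorConst c hs hμs =>
    have h1 := indicatorConstLp_coeFn (p := 1) (hs := hs) (hμs := hμs.ne) (c := c)
    have h2 := indicatorConstLp_coeFn (p := 2) (hs := hs) (hμs := hμs.ne) (c := c)
    rw [Lp.simpleFunc.coe_indicatorConst]
    convert hrep (indicatorConstLp 2 hs hμs.ne c) using 1
    · congr 1
      refine Lp.ext ?_
      filter_upwards [(hmem (indicatorConstLp 2 hs hμs.ne c)).coeFn_toLp, h1, h2] with x h3 h4 h5
      rw [h3, h4, h5]
    · refine integral_congr_ae ?_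
      filter_upwards [h1, h2] with x h3 h4
      rw [h3, h4]
  | add hf hg _ hf' hg' =>
    rw [map_add, hf', hg', ← integral_add (hint _ (L1.integrable_coeFn _))
      (hint _ (L1.integrable_coeFn _))]
    refine integral_congr_ae ?_
    filter_upwards [Lp.coeFn_add (hf.toLp _) (hg.toLp _)] with x hx
    rw [hx, Pi.add_apply, inner_add_right]
  | isClosed => exact isClosed_eq l.continuous hcont

end DualOfL1

/-! ### Hahn-Banach separation and integral functionals on L¹ -/

section Separation

/-- If a continuous convex function is bounded below by `m` on a subspace `V`, then it is bounded
below by `m + l` on the whole space, for some continuous linear functional `l` vanishing on `V`. -/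
theorem ConvexOn.exists_dual_eq_zero_on_submodule {X : Type*} [NormedAddCommGroup X]
    [NormedSpace ℝ X] {Φ : X → ℝ} (hc : ConvexOn ℝ Set.univ Φ) (hcont : Continuous Φ)
    (V : Submodule ℝ X) {m : ℝ} (hm : ∀ v ∈ V, m ≤ Φ v) :
    ∃ l : StrongDual ℝ X, (∀ v ∈ V, l v = 0) ∧ ∀ g, m + l g ≤ Φ g := by
  have hs : Convex ℝ {p : X × ℝ | p.1 ∈ Set.univ ∧ Φ p.1 < p.2} := hc.convex_strict_epigraph
  simp only [Set.mem_univ, true_and] at hs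
  have ho : IsOpen {p : X × ℝ | Φ p.1 < p.2} :=
    isOpen_lt (hcont.comp continuous_fst) continuous_snd
  have hdisj : Disjoint {p : X × ℝ | Φ p.1 < p.2} ((V : Set X) ×ˢ {m}) := by
    rw [Set.disjoint_left]
    rintro ⟨g, t⟩ h1 ⟨h2, h3⟩
    have h1 : Φ g < t := h1
    have h3 : t = m := h3
    have := hm g h2
    linarith
  obtain ⟨f, u, h1, h2⟩ := geometric_hahn_banach_open hs ho
    (V.convex.prod (convex_singleton m)) hdisj
  set l : StrongDual ℝ X := f.comp (ContinuousLinearMap.inl ℝ X ℝ) with hl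
  set c : ℝ := f (0, 1) with hcdef
  have hf (g : X) (t : ℝ) : f (g, t) = l g + t * c := by
    have : ((g, t) : X × ℝ) = (g, 0) + t • (0, 1) := by simp
    rw [this, map_add, map_smul, smul_eq_mul]
    rfl
  have hA (g : X) (t : ℝ) (ht : Φ g < t) : l g + t * c < u := by
    rw [← hf]
    exact h1 _ ht
  have hB (v : X) (hv : v ∈ V) : u ≤ l v + m * c := by
    rw [← hf]
    exact h2 _ ⟨hv, rfl⟩
  -- A linear functional bounded below on a subspace vanishes there: the chosen multiple of v would
  -- violate the bound by 1.
  have hlV (v : X) (hv : v ∈ V) : l v = 0 := by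
    by_contra hne
    have h3 := hB (((u - m * c - 1) / l v) • v) (V.smul_mem _ hv)
    rw [map_smul, smul_eq_mul, div_mul_cancel₀ _ hne] at h3
    linarith
  have hu : u ≤ m * c := by simpa using hB 0 V.zero_mem
  -- The hyperplane is not vertical, because points above the graph over 0 are strictly separated
  -- from (0, m) and m ≤ Φ 0. Dividing by -c then turns it into an affine minorant.
  have hc0 : c < 0 := by
    have h3 := hA 0 (Φ 0 + 1) (by linarith)
    rw [map_zero] at h3
    have := hm 0 V.zero_mem
    nlinarith
  refine ⟨(-c)⁻¹ • l, fun v hv => by simp [hlV v hv], fun g => ?_⟩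
  refine le_of_forall_pos_le_add fun ε hε => ?_
  have h3 := hA g (Φ g + ε) (by linarith)
  have h4 : l g ≤ (Φ g + ε - m) * (-c) := by linarith
  have h5 : (-c)⁻¹ * l g ≤ Φ g + ε - m := by
    rw [inv_mul_le_iff₀ (by linarith), mul_comm]
    exact h4
  simp only [smul_apply, smul_eq_mul]
  linarith

variable {α E : Type*} [MeasurableSpace α] {μ : Measure α} [IsFiniteMeasure μ]
  [NormedAddCommGroup E] [InnerProductSpace ℝ E] {F : E → ℝ} {T : α → E} {L B : ℝ}

omit [InnerProductSpace ℝ E] in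
theorem integrable_comp_of_lipschitz (hF : ∀ y z, |F y - F z| ≤ L * ‖y - z‖)
    (hcont : Continuous F) {g : α → E} (hg : Integrable g μ) :
    Integrable (fun x => F (g x)) μ := by
  refine ((integrable_const |F 0|).add (hg.norm.const_mul L)).mono'
    (hcont.comp_aestronglyMeasurable hg.1) (Eventually.of_forall fun x => ?_)
  have h := hF (g x) 0
  rw [sub_zero] at h
  show |F (g x)| ≤ |F 0| + L * ‖g x‖
  calc |F (g x)| = |F 0 + (F (g x) - F 0)| := by rw [add_sub_cancel]
    _ ≤ _ := (abs_add_le _ _).trans (by linarith)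

theorem integrable_sub_inner (hF : ∀ y z, |F y - F z| ≤ L * ‖y - z‖) (hcont : Continuous F)
    (hT : AEStronglyMeasurable T μ) (hB : ∀ᵐ x ∂μ, ‖T x‖ ≤ B) {g : α → E}
    (hg : Integrable g μ) : Integrable (fun x => F (g x) - inner ℝ (T x) (g x)) μ :=
  (integrable_comp_of_lipschitz hF hcont hg).sub (Integrable.inner_of_bound hT hB hg)

theorem continuous_integral_sub_inner (hL : 0 ≤ L) (hF : ∀ y z, |F y - F z| ≤ L * ‖y - z‖)
    (hcont : Continuous F) (hT : AEStronglyMeasurable T μ) (hB : ∀ᵐ x ∂μ, ‖T x‖ ≤ B) :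
    Continuous fun g : Lp E 1 μ => ∫ x, (F (g x) - inner ℝ (T x) (g x)) ∂μ := by
  have hi (g : Lp E 1 μ) := integrable_sub_inner hF hcont hT hB (L1.integrable_coeFn g)
  refine (LipschitzWith.of_dist_le_mul (K := (L + |B|).toNNReal) fun f g => ?_).continuous
  rw [Real.dist_eq, dist_eq_norm, L1.norm_eq_integral_norm, Real.coe_toNNReal _ (by positivity),
    ← integral_sub (hi f) (hi g), ← integral_const_mul]
  refine (abs_integral_le_integral_abs).trans (integral_mono_ae ((hi f).sub (hi g)).abs
    ((L1.integrable_coeFn (f - g)).norm.const_mul _) ?_)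
  filter_upwards [hB, Lp.coeFn_sub f g] with x hx hs
  rw [hs, Pi.sub_apply]
  have h1 := hF (f x) (g x)
  have h2 : |inner ℝ (T x) (f x - g x)| ≤ |B| * ‖f x - g x‖ :=
    (abs_real_inner_le_norm _ _).trans
      (mul_le_mul_of_nonneg_right (hx.trans (le_abs_self B)) (norm_nonneg _))
  calc |F (f x) - inner ℝ (T x) (f x) - (F (g x) - inner ℝ (T x) (g x))|
      = |(F (f x) - F (g x)) - inner ℝ (T x) (f x - g x)| := by rw [inner_sub_right]; ring_nf
    _ ≤ |F (f x) - F (g x)| + |inner ℝ (T x) (f x - g x)| := abs_sub _ _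
    _ ≤ (L + |B|) * ‖f x - g x‖ := by linarith

theorem convexOn_integral_sub_inner (hconv : ConvexOn ℝ Set.univ F)
    (hF : ∀ y z, |F y - F z| ≤ L * ‖y - z‖)
    (hcont : Continuous F) (hT : AEStronglyMeasurable T μ) (hB : ∀ᵐ x ∂μ, ‖T x‖ ≤ B) :
    ConvexOn ℝ Set.univ
      fun g : Lp E 1 μ => ∫ x, (F (g x) - inner ℝ (T x) (g x)) ∂μ := by
  have hi (g : Lp E 1 μ) := integrable_sub_inner hF hcont hT hB (L1.integrable_coeFn g)
  refine ⟨convex_univ, fun f _ g _ a b ha hb hab => ?_⟩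
  simp only [smul_eq_mul]
  rw [← integral_const_mul, ← integral_const_mul,
    ← integral_add ((hi f).const_mul a) ((hi g).const_mul b)]
  refine integral_mono_ae (hi _) (((hi f).const_mul a).add ((hi g).const_mul b)) ?_
  filter_upwards [Lp.coeFn_add (a • f) (b • g), Lp.coeFn_smul a f, Lp.coeFn_smul b g]
    with x h1 h2 h3
  have h4 := hconv.2 (Set.mem_univ (f x)) (Set.mem_univ (g x)) ha hb hab
  simp only [smul_eq_mul] at h4
  show _ ≤ a * (F (f x) - inner ℝ (T x) (f x)) + b * (F (g x) - inner ℝ (T x) (g x))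
  rw [h1, Pi.add_apply, h2, h3, Pi.smul_apply, Pi.smul_apply, inner_add_right, inner_smul_right,
    inner_smul_right]
  linarith

/-- A lower bound for the integral functional on a subspace of `L¹` extends to all of `L¹` after
adding a suitable annihilator of the subspace in `L^∞`. -/
theorem exists_annihilator_le_integral [CompleteSpace E] (hconv : ConvexOn ℝ Set.univ F)
    (hL : 0 ≤ L) (hF : ∀ y z, |F y - F z| ≤ L * ‖y - z‖)
    (hcont : Continuous F) (hT : AEStronglyMeasurable T μ) (hB : ∀ᵐ x ∂μ, ‖T x‖ ≤ B)
    (V : Submodule ℝ (Lp E 1 μ)) {m : ℝ}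
    (hm : ∀ v ∈ V, m ≤ ∫ x, (F (v x) - inner ℝ (T x) (v x)) ∂μ) :
    ∃ χ : Lp E ∞ μ, (∀ v ∈ V, ∫ x, inner ℝ (χ x) (v x) ∂μ = 0) ∧
      ∀ g : Lp E 1 μ, m ≤ ∫ x, (F (g x) - inner ℝ (T x + χ x) (g x)) ∂μ := by
  obtain ⟨l, hlV, hl⟩ := (convexOn_integral_sub_inner (μ := μ) hconv hF hcont hT hB
    ).exists_dual_eq_zero_on_submodule (continuous_integral_sub_inner hL hF hcont hT hB) V hm
  obtain ⟨χ, hχ⟩ := exists_Linfty_repr l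
  obtain ⟨C, hC⟩ := Lp.exists_ae_norm_le χ
  refine ⟨χ, fun v hv => by rw [← hχ, hlV v hv], fun g => ?_⟩
  have h := hl g
  have hg := L1.integrable_coeFn g
  have h1 : ∀ x, F (g x) - inner ℝ (T x + χ x) (g x)
      = (F (g x) - inner ℝ (T x) (g x)) - inner ℝ (χ x) (g x) := fun x => by
    rw [inner_add_left]; ring
  simp_rw [h1]
  rw [integral_sub (integrable_sub_inner hF hcont hT hB hg)
    (Integrable.inner_of_bound (Lp.aestronglyMeasurable χ) hC hg), ← hχ]
  linarith

end Separation

/-! ### Exchanging supremum and integral by measurable selection -/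

section Interchange

variable {α E : Type*} [NormedAddCommGroup E] [InnerProductSpace ℝ E]

/-- The `k`-th function picks, for each `x`, a maximiser of `⟪q x, z⟫ - F z` among `z = 0` and the
first `k` members of a dense sequence. -/
noncomputable def maximisingSelection [TopologicalSpace.SeparableSpace E] (F : E → ℝ)
    (q : α → E) : ℕ → α → E
  | 0, _ => 0
  | k + 1, x =>
    if inner ℝ (q x) (maximisingSelection F q k x) - F (maximisingSelection F q k x)
        ≤ inner ℝ (q x) (TopologicalSpace.denseSeq E k) - F (TopologicalSpace.denseSeq E k) then
      TopologicalSpace.denseSeq E k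
    else maximisingSelection F q k x

variable [FiniteDimensional ℝ E] {F : E → ℝ} {q : α → E}

theorem monotone_maximisingSelection (x : α) : Monotone fun k =>
    inner ℝ (q x) (maximisingSelection F q k x) - F (maximisingSelection F q k x) := by
  refine monotone_nat_of_le_succ fun k => ?_
  rw [maximisingSelection]
  split_ifs with h
  · exact h
  · exact le_rfl

/-- Only finitely many values occur at each stage, so every selection is an admissible L¹
competitor. -/
theorem norm_maximisingSelection_le (k : ℕ) :
    ∃ B, ∀ x, ‖maximisingSelection F q k x‖ ≤ B := by
  induction k with
  | zero => exact ⟨0, fun x => by simp [maximisingSelection]⟩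
  | succ k ih =>
    obtain ⟨B, hB⟩ := ih
    refine ⟨max B ‖TopologicalSpace.denseSeq E k‖, fun x => ?_⟩
    rw [maximisingSelection]
    split_ifs with h
    · exact le_max_right _ _
    · exact (hB x).trans (le_max_left _ _)

theorem measurable_maximisingSelection [MeasurableSpace α] [MeasurableSpace E] [BorelSpace E] (hF : Continuous F)
    (hq : Measurable q) (k : ℕ) : Measurable (maximisingSelection F q k) := by
  induction k with
  | zero =>
    have : maximisingSelection F q 0 = fun _ => (0 : E) := by
      ext x; simp [maximisingSelection]
    rw [this]
    exact measurable_const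
  | succ k ih =>
    have : maximisingSelection F q (k + 1) = fun x =>
        if inner ℝ (q x) (maximisingSelection F q k x) - F (maximisingSelection F q k x)
          ≤ inner ℝ (q x) (TopologicalSpace.denseSeq E k) - F (TopologicalSpace.denseSeq E k) then
        TopologicalSpace.denseSeq E k else maximisingSelection F q k x := by
      ext x; rw [maximisingSelection]
    rw [this]
    refine Measurable.ite (measurableSet_le ?_ ?_) measurable_const ih
    · exact (hq.inner ih).sub (hF.measurable.comp ih)
    · exact (hq.inner measurable_const).sub measurable_const

theorem inner_sub_le_of_maximisingSelection (hF : Continuous F) {x : α} {c : ℝ}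
    (hc : ∀ k, inner ℝ (q x) (maximisingSelection F q k x) - F (maximisingSelection F q k x) ≤ c)
    (z : E) : inner ℝ (q x) z - F z ≤ c := by
  have hclosed : IsClosed {z : E | inner ℝ (q x) z - F z ≤ c} :=
    isClosed_le (by fun_prop) continuous_const
  have hsub : Set.range (TopologicalSpace.denseSeq E) ⊆ {z : E | inner ℝ (q x) z - F z ≤ c} := by
    rintro _ ⟨k, rfl⟩
    have h := hc (k + 1)
    rw [maximisingSelection] at h
    split_ifs at h with h1
    · exact h
    · exact (not_le.1 h1).le.trans (hc k)
  exact (closure_minimal hsub hclosed) (TopologicalSpace.denseRange_denseSeq E z)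

/-- The supremum of `∫ (⟪q, g⟫ - F g)` over `g ∈ L¹` controls the integral of the pointwise
supremum. -/
theorem exists_integrable_conjugate [MeasurableSpace α] {μ : Measure α} [IsFiniteMeasure μ]
    [MeasurableSpace E] [BorelSpace E] {L B : ℝ}
    (hF : ∀ y z, |F y - F z| ≤ L * ‖y - z‖) (hcont : Continuous F)
    (hq : Measurable q) (hB : ∀ᵐ x ∂μ, ‖q x‖ ≤ B) {m : ℝ}
    (hm : ∀ g : Lp E 1 μ, m ≤ ∫ x, (F (g x) - inner ℝ (q x) (g x)) ∂μ) :
    ∃ f : α → ℝ, Integrable f μ ∧ ∫ x, f x ∂μ ≤ -m ∧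
      ∀ᵐ x ∂μ, IsLUB (Set.range fun z => inner ℝ (q x) z - F z) (f x) := by
  set g := maximisingSelection F q with hg
  set v : ℕ → α → ℝ := fun k x => inner ℝ (q x) (g k x) - F (g k x) with hv
  have hgm (k : ℕ) : Measurable (g k) := measurable_maximisingSelection hcont hq k
  have hgi (k : ℕ) : MemLp (g k) 1 μ := by
    obtain ⟨C, hC⟩ := norm_maximisingSelection_le (F := F) (q := q) k
    exact (memLp_top_of_bound (hgm k).aestronglyMeasurable C
      (Eventually.of_forall hC)).mono_exponent le_top
  have hvm (k : ℕ) : Measurable (v k) := (hq.inner (hgm k)).sub (hcont.measurable.comp (hgm k))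
  have hvi (k : ℕ) : Integrable (v k) μ := by
    have := (integrable_sub_inner hF hcont hq.aestronglyMeasurable hB
      (memLp_one_iff_integrable.1 (hgi k))).neg
    refine this.congr (Eventually.of_forall fun x => ?_)
    simp [hv]
  have hvle (k : ℕ) : ∫ x, v k x ∂μ ≤ -m := by
    have h1 := hm ((hgi k).toLp _)
    have h2 : ∫ x, (F (((hgi k).toLp _ : Lp E 1 μ) x)
        - inner ℝ (q x) (((hgi k).toLp _ : Lp E 1 μ) x)) ∂μ = -∫ x, v k x ∂μ := by
      rw [← integral_neg]
      refine integral_congr_ae ?_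
      filter_upwards [(hgi k).coeFn_toLp] with x hx
      rw [hx]
      simp [hv]
    linarith
  -- The selection starts at z = 0 with value -F 0; adding F 0 makes the increasing sequence
  -- nonnegative, as monotone convergence in `ℝ≥0∞` requires.
  have hv0 (k : ℕ) (x : α) : 0 ≤ v k x + F 0 := by
    have h := monotone_maximisingSelection (F := F) (q := q) x (Nat.zero_le k)
    simp only [maximisingSelection, inner_zero_right, zero_sub] at h
    linarith
  set G : α → ℝ≥0∞ := fun x => ⨆ k, ENNReal.ofReal (v k x + F 0) with hG
  have hGm : Measurable G := Measurable.iSup fun k => ((hvm k).add_const _).ennreal_ofReal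
  have hGle : ∫⁻ x, G x ∂μ ≤ ENNReal.ofReal (-m + μ.real Set.univ * F 0) := by
    rw [lintegral_iSup (fun k => ((hvm k).add_const _).ennreal_ofReal)]
    · refine iSup_le fun k => ?_
      rw [← ofReal_integral_eq_lintegral_ofReal (f := fun x => v k x + F 0)
        ((hvi k).add (integrable_const _)) (Eventually.of_forall (hv0 k))]
      refine ENNReal.ofReal_le_ofReal ?_
      rw [integral_add (hvi k) (integrable_const _), integral_const, smul_eq_mul]
      linarith [hvle k]
    · intro k l hkl x
      exact ENNReal.ofReal_le_ofReal
        (add_le_add_left (monotone_maximisingSelection (F := F) (q := q) x hkl) _)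
  have hGtop : ∫⁻ x, G x ∂μ ≠ ⊤ := ne_top_of_le_ne_top ENNReal.ofReal_ne_top hGle
  have hGi : Integrable (fun x => (G x).toReal) μ :=
    integrable_toReal_of_lintegral_ne_top hGm.aemeasurable hGtop
  have hnonneg : 0 ≤ -m + μ.real Set.univ * F 0 := by
    have h1 : 0 ≤ ∫ x, (v 0 x + F 0) ∂μ := integral_nonneg (hv0 0)
    rw [integral_add (hvi 0) (integrable_const _), integral_const, smul_eq_mul] at h1
    linarith [hvle 0]
  refine ⟨fun x => (G x).toReal - F 0, hGi.sub (integrable_const _), ?_, ?_⟩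
  · rw [integral_sub hGi (integrable_const _), integral_const, smul_eq_mul,
      integral_toReal hGm.aemeasurable (ae_lt_top hGm hGtop)]
    have := ENNReal.toReal_le_of_le_ofReal hnonneg hGle
    linarith
  · filter_upwards [ae_lt_top hGm hGtop] with x hx
    constructor
    · rintro _ ⟨z, rfl⟩
      refine inner_sub_le_of_maximisingSelection hcont (fun k => ?_) z
      have h1 : ENNReal.ofReal (v k x + F 0) ≤ G x :=
        le_iSup (fun k => ENNReal.ofReal (v k x + F 0)) k
      have h2 := ENNReal.toReal_mono hx.ne h1
      rw [ENNReal.toReal_ofReal (hv0 k x)] at h2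
      show v k x ≤ _
      linarith
    · intro c hc
      have hvc (k : ℕ) : v k x ≤ c := hc ⟨g k x, rfl⟩
      have h1 : G x ≤ ENNReal.ofReal (c + F 0) :=
        iSup_le fun k => ENNReal.ofReal_le_ofReal (by linarith [hvc k])
      have h2 := ENNReal.toReal_le_of_le_ofReal (by linarith [hvc 0, hv0 0 x]) h1
      linarith

end Interchange

namespace NeumannDuality

/-! ### The conjugate function and its extended integral -/

section Conjugate

variable {N n : ℕ} {F : Mat N n → ℝ}

theorem conjugate_eq_coe_of_isLUB {q : Mat N n} {c : ℝ}
    (h : IsLUB (Set.range fun z => inner ℝ q z - F z) c) : conjugate F q = c := by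
  refine le_antisymm (iSup_le fun z => by exact_mod_cast h.1 ⟨z, rfl⟩) ?_
  refine le_of_forall_lt fun b hb => ?_
  obtain ⟨r, hbr, hrc⟩ := EReal.lt_iff_exists_real_btwn.1 hb
  obtain ⟨_, ⟨z, rfl⟩, hz⟩ := (lt_isLUB_iff h).1 (EReal.coe_lt_coe_iff.1 hrc)
  exact (hbr.trans (EReal.coe_lt_coe_iff.2 hz)).trans_le
    (le_iSup (fun z : Mat N n => ((inner ℝ q z - F z : ℝ) : EReal)) z)

/-- Take z = 0. On a finite measure this keeps the negative part of the integral finite, so ∞ - ∞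
never arises. -/
theorem neg_le_conjugate (q : Mat N n) : ((-F 0 : ℝ) : EReal) ≤ conjugate F q := by
  have h := le_iSup (fun z : Mat N n => ((inner ℝ q z - F z : ℝ) : EReal)) 0
  rwa [inner_zero_right, zero_sub] at h

theorem measurable_conjugate : Measurable (conjugate F) := by
  refine LowerSemicontinuous.measurable (lowerSemicontinuous_iSup fun z => ?_)
  refine Continuous.lowerSemicontinuous ?_
  exact continuous_coe_real_ereal.comp (by fun_prop)

theorem erealIntegral_of_ae_eq_coe {α : Type*} [MeasurableSpace α] {μ : Measure α} {g : α → EReal}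
    {f : α → ℝ} (hf : Integrable f μ) (hgf : ∀ᵐ x ∂μ, g x = f x) :
    erealIntegral μ g = ((∫ x, f x ∂μ : ℝ) : EReal) := by
  have h1 : ∫⁻ x, (g x).toENNReal ∂μ = ∫⁻ x, ENNReal.ofReal (f x) ∂μ := by
    refine lintegral_congr_ae ?_
    filter_upwards [hgf] with x hx
    rw [hx, EReal.toENNReal_of_ne_top (EReal.coe_ne_top _), EReal.toReal_coe]
  have h2 : ∫⁻ x, (-(g x)).toENNReal ∂μ = ∫⁻ x, ENNReal.ofReal (-f x) ∂μ := by
    refine lintegral_congr_ae ?_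
    filter_upwards [hgf] with x hx
    rw [hx, ← EReal.coe_neg, EReal.toENNReal_of_ne_top (EReal.coe_ne_top _), EReal.toReal_coe]
  have h3 : ∫⁻ x, ENNReal.ofReal (-f x) ∂μ ≠ ⊤ := hf.neg.lintegral_lt_top.ne
  rw [erealIntegral, h1, h2, integral_eq_lintegral_pos_part_sub_lintegral_neg_part hf,
    EReal.coe_sub, EReal.coe_ennreal_toReal hf.lintegral_lt_top.ne,
    EReal.coe_ennreal_toReal h3]

/-- The integral of the conjugate function is either `∞` or that of a real integrable function. -/
theorem erealIntegral_conjugate {α : Type*} [MeasurableSpace α] {μ : Measure α}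
    [IsFiniteMeasure μ] {q : α → Mat N n} (hq : Measurable q) :
    erealIntegral μ (fun x => conjugate F (q x)) = ⊤ ∨
      ∃ f : α → ℝ, Integrable f μ ∧ (∀ᵐ x ∂μ, conjugate F (q x) = f x) ∧
        erealIntegral μ (fun x => conjugate F (q x)) = ((∫ x, f x ∂μ : ℝ) : EReal) := by
  have hm : Measurable fun x => conjugate F (q x) := measurable_conjugate.comp hq
  have hneg : ∫⁻ x, (-(conjugate F (q x))).toENNReal ∂μ ≠ ⊤ := by
    refine ne_top_of_le_ne_top (b := ∫⁻ _, ENNReal.ofReal (F 0) ∂μ) ?_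
      (lintegral_mono fun x => ?_)
    · rw [lintegral_const]
      exact ENNReal.mul_ne_top ENNReal.ofReal_ne_top (measure_ne_top _ _)
    · have h := EReal.neg_le_neg_iff.2 (neg_le_conjugate (F := F) (q x))
      rw [← EReal.coe_neg, neg_neg] at h
      have h1 := EReal.toENNReal_le_toENNReal h
      rwa [EReal.toENNReal_of_ne_top (EReal.coe_ne_top _), EReal.toReal_coe] at h1
  by_cases hpos : ∫⁻ x, (conjugate F (q x)).toENNReal ∂μ = ⊤
  · left
    rw [erealIntegral, hpos]
    lift ∫⁻ x, (-(conjugate F (q x))).toENNReal ∂μ to NNReal using hneg with r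
    exact EReal.top_sub_coe r
  · right
    have hlt : ∀ᵐ x ∂μ, conjugate F (q x) < ⊤ := by
      filter_upwards [ae_lt_top hm.ereal_toENNReal hpos] with x hx
      rw [lt_top_iff_ne_top]
      rintro h
      rw [h] at hx
      simp at hx
    have hbot (x : α) : conjugate F (q x) ≠ ⊥ := fun h => by
      have := neg_le_conjugate (F := F) (q x)
      rw [h, le_bot_iff] at this
      exact EReal.coe_ne_bot _ this
    have hae : ∀ᵐ x ∂μ, conjugate F (q x) = ((conjugate F (q x)).toReal : ℝ) := by
      filter_upwards [hlt] with x hx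
      exact (EReal.coe_toReal hx.ne (hbot x)).symm
    have hint : Integrable (fun x => (conjugate F (q x)).toReal) μ := by
      refine ⟨hm.ereal_toReal.aestronglyMeasurable, ?_⟩
      have hle : ∫⁻ x, ‖(conjugate F (q x)).toReal‖ₑ ∂μ ≤
          ∫⁻ x, ((conjugate F (q x)).toENNReal + (-(conjugate F (q x))).toENNReal) ∂μ := by
        refine lintegral_mono_ae ?_
        filter_upwards [hae] with x hx
        rw [hx, EReal.toReal_coe, ← EReal.coe_neg,
          EReal.toENNReal_of_ne_top (EReal.coe_ne_top _), EReal.toReal_coe,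
          EReal.toENNReal_of_ne_top (EReal.coe_ne_top _), EReal.toReal_coe, Real.enorm_eq_ofReal_abs]
        rcases le_total 0 (conjugate F (q x)).toReal with h | h
        · rw [abs_of_nonneg h]; exact le_self_add
        · rw [abs_of_nonpos h]; exact le_add_self
      refine hle.trans_lt ?_
      rw [lintegral_add_left hm.ereal_toENNReal]
      exact ENNReal.add_lt_top.2 ⟨lt_top_iff_ne_top.2 hpos, lt_top_iff_ne_top.2 hneg⟩
    exact ⟨_, hint, hae, erealIntegral_of_ae_eq_coe hint hae⟩

end Conjugate

end NeumannDuality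

/-! ### From vanishing Fenchel gaps to weak-* convergence -/

section Convergence

variable {α E : Type*} [MeasurableSpace α] {μ : Measure α} [IsFiniteMeasure μ]

/-- If `a k / (1 + b k) → 0` almost everywhere and `b k` is bounded in `L¹`, then `a k → 0` in
measure. -/
theorem tendstoInMeasure_zero_of_div {a b : ℕ → α → ℝ} (ha : ∀ k, AEStronglyMeasurable (a k) μ)
    (hb : ∀ k, Integrable (b k) μ) (hb0 : ∀ k x, 0 ≤ b k x) {C : ℝ}
    (hC : ∀ k, ∫ x, b k x ∂μ ≤ C)
    (h : ∀ᵐ x ∂μ, Tendsto (fun k => a k x / (1 + b k x)) atTop (𝓝 0)) :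
    TendstoInMeasure μ a atTop fun _ => 0 := by
  have hmeas (k : ℕ) : AEStronglyMeasurable (fun x => a k x / (1 + b k x)) μ :=
    ((ha k).aemeasurable.div (aemeasurable_const.add (hb k).1.aemeasurable)).aestronglyMeasurable
  have h1 := tendstoInMeasure_iff_measureReal_norm.1
    (tendstoInMeasure_of_tendsto_ae (g := fun _ => (0 : ℝ)) hmeas h)
  rw [tendstoInMeasure_iff_measureReal_norm]
  intro ε hε
  simp only [sub_zero] at h1 ⊢
  rw [Metric.tendsto_atTop]
  intro η hη
  -- By Markov's inequality b k ≥ M on measure below η / 2; elsewhere ‖a k‖ ≥ ε forces the quotient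
  -- to be at least ε / (1 + M).
  set M : ℝ := (|C| + 1) / (η / 2) with hM
  have hM0 : 0 < M := by positivity
  obtain ⟨k₀, hk₀⟩ := Metric.tendsto_atTop.1 (h1 (ε / (1 + M)) (by positivity)) (η / 2)
    (half_pos hη)
  refine ⟨k₀, fun k hk => ?_⟩
  have h2 := hk₀ k hk
  rw [Real.dist_0_eq_abs, abs_of_nonneg measureReal_nonneg] at h2 ⊢
  have h3 : μ.real {x | M ≤ b k x} < η / 2 := by
    have h4 := mul_meas_ge_le_integral_of_nonneg (Eventually.of_forall (hb0 k)) (hb k) M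
    have h5 : M * μ.real {x | M ≤ b k x} < M * (η / 2) := by
      rw [hM, div_mul_cancel₀ _ (half_pos hη).ne', ← hM]
      linarith [hC k, le_abs_self C]
    exact lt_of_mul_lt_mul_left h5 hM0.le
  have hsub : {x | ε ≤ ‖a k x‖} ⊆
      {x | ε / (1 + M) ≤ ‖a k x / (1 + b k x)‖} ∪ {x | M ≤ b k x} := by
    intro x hx
    by_cases hbx : M ≤ b k x
    · exact Or.inr hbx
    · left
      have hx : ε ≤ ‖a k x‖ := hx
      have hp : 0 < 1 + b k x := by linarith [hb0 k x]
      show ε / (1 + M) ≤ ‖a k x / (1 + b k x)‖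
      rw [norm_div, Real.norm_of_nonneg hp.le]
      exact div_le_div₀ (norm_nonneg _) hx hp (by linarith)
  calc μ.real {x | ε ≤ ‖a k x‖}
      ≤ μ.real ({x | ε / (1 + M) ≤ ‖a k x / (1 + b k x)‖} ∪ {x | M ≤ b k x}) :=
        measureReal_mono hsub
    _ ≤ _ := measureReal_union_le _ _
    _ < η := by linarith

/-- Nonnegative functions whose integrals tend to zero tend to zero almost everywhere along a
subsequence. -/
theorem exists_subseq_tendsto_zero_of_integral {α : Type*} [MeasurableSpace α] {μ : Measure α}
    {s : ℕ → α → ℝ} (hs : ∀ k, Integrable (s k) μ)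
    (hs0 : ∀ k, ∀ᵐ x ∂μ, 0 ≤ s k x) (h : Tendsto (fun k => ∫ x, s k x ∂μ) atTop (𝓝 0)) :
    ∃ ms : ℕ → ℕ, StrictMono ms ∧ ∀ᵐ x ∂μ, Tendsto (fun k => s (ms k) x) atTop (𝓝 0) := by
  have h1 : TendstoInMeasure μ s atTop fun _ => (0 : ℝ) := by
    refine tendstoInMeasure_of_tendsto_eLpNorm (p := 1) one_ne_zero (fun k => (hs k).1)
      aestronglyMeasurable_const ?_
    have h2 (k : ℕ) : eLpNorm (s k - fun _ => (0 : ℝ)) 1 μ = ENNReal.ofReal (∫ x, s k x ∂μ) := by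
      rw [ofReal_integral_eq_lintegral_ofReal (hs k) (hs0 k), eLpNorm_one_eq_lintegral_enorm]
      refine lintegral_congr_ae ?_
      filter_upwards [hs0 k] with x hx
      rw [Pi.sub_apply, sub_zero, Real.enorm_eq_ofReal hx]
    simp_rw [h2]
    simpa using ENNReal.tendsto_ofReal h
  exact h1.exists_seq_tendsto_ae

variable [NormedAddCommGroup E] [InnerProductSpace ℝ E] [FiniteDimensional ℝ E]
  {F : E → ℝ}

/-- If the gaps in the Fenchel inequality tend to zero in `L¹` along a sequence that is bounded
in `L¹`, then the gradients converge weakly-* in `L^∞`. -/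
theorem tendsto_integral_inner_gradient_sub (hF : ContDiff ℝ 1 F) {L B C : ℝ}
    (hL : ∀ z, ‖gradient F z‖ ≤ L) {q : α → E} (hq : AEStronglyMeasurable q μ)
    (hB : ∀ᵐ x ∂μ, ‖q x‖ ≤ B) {f : α → ℝ} (hf : ∀ᵐ x ∂μ, ∀ z, inner ℝ (q x) z - F z ≤ f x)
    {g : ℕ → α → E} (hg : ∀ k, Integrable (g k) μ) (hgC : ∀ k, ∫ x, ‖g k x‖ ∂μ ≤ C)
    (hsi : ∀ k, Integrable (fun x => F (g k x) + f x - inner ℝ (q x) (g k x)) μ)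
    (hs : Tendsto (fun k => ∫ x, (F (g k x) + f x - inner ℝ (q x) (g k x)) ∂μ) atTop (𝓝 0))
    {h : α → E} (hh : Integrable h μ) :
    Tendsto (fun k => ∫ x, inner ℝ (gradient F (g k x) - q x) (h x) ∂μ) atTop (𝓝 0) := by
  have hgrad (k : ℕ) : AEStronglyMeasurable (fun x => gradient F (g k x)) μ :=
    (continuous_gradient hF).comp_aestronglyMeasurable (hg k).1
  have hd (k : ℕ) : AEStronglyMeasurable (fun x => gradient F (g k x) - q x) μ := (hgrad k).sub hq
  have hdB : ∀ᵐ x ∂μ, ∀ z, ‖gradient F z - q x‖ ≤ L + B := by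
    filter_upwards [hB] with x hx z
    exact (norm_sub_le _ _).trans (add_le_add (hL z) hx)
  -- Almost everywhere convergence holds only along subsequences, but the limit 0 is always the
  -- same, so the whole sequence converges.
  refine tendsto_of_subseq_tendsto fun ns hns => ?_
  obtain ⟨ms, -, hms⟩ := exists_subseq_tendsto_zero_of_integral (fun k => hsi (ns k))
    (fun k => by
      filter_upwards [hf] with x hx
      linarith [hx (g (ns k) x)]) (hs.comp hns)
  have h1 : TendstoInMeasure μ
      (fun k x => ‖gradient F (g (ns (ms k)) x) - q x‖) atTop fun _ => 0 := by
    refine tendstoInMeasure_zero_of_div (b := fun k x => ‖g (ns (ms k)) x‖)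
      (fun k => (hd _).norm) (fun k => (hg _).norm)
      (fun _ _ => norm_nonneg _) (fun k => hgC _) ?_
    filter_upwards [hms, hf, hdB] with x h2 h3 h4
    exact tendsto_norm_gradient_sub_div hF h3 h4 h2
  obtain ⟨ls, -, hls⟩ := h1.exists_seq_tendsto_ae
  refine ⟨fun k => ms (ls k), ?_⟩
  rw [show (0 : ℝ) = ∫ _ : α, (0 : ℝ) ∂μ by simp]
  refine tendsto_integral_of_dominated_convergence (fun x => (L + B) * ‖h x‖)
    (fun k => (hd _).inner hh.1) (hh.norm.const_mul _) (fun k => ?_) ?_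
  · filter_upwards [hdB] with x hx
    exact (norm_inner_le_norm _ _).trans (mul_le_mul_of_nonneg_right (hx _) (norm_nonneg _))
  · filter_upwards [hls] with x hx
    refine squeeze_zero_norm (fun k => norm_inner_le_norm _ _) ?_
    simpa using hx.mul_const ‖h x‖

end Convergence

namespace NeumannDuality

/-! ### Weak gradients form a subspace of L¹ -/

section Sobolev

variable {N n : ℕ} {Ω : Set (Vec n)}

theorem IsWeakGradient.congr_ae {u u' : Vec n → Vec N} {G G' : Vec n → Mat N n}
    (h : IsWeakGradient Ω u G) (hu : u' =ᵐ[leb Ω] u) (hG : G' =ᵐ[leb Ω] G) :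
    IsWeakGradient Ω u' G' := by
  intro φ h1 h2 h3 i j
  have e1 : ∫ x, u' x i * fderiv ℝ φ x (EuclideanSpace.single j 1) ∂(leb Ω)
      = ∫ x, u x i * fderiv ℝ φ x (EuclideanSpace.single j 1) ∂(leb Ω) := by
    refine integral_congr_ae ?_
    filter_upwards [hu] with x hx
    rw [hx]
  have e2 : ∫ x, G' x (i, j) * φ x ∂(leb Ω) = ∫ x, G x (i, j) * φ x ∂(leb Ω) := by
    refine integral_congr_ae ?_
    filter_upwards [hG] with x hx
    rw [hx]
  rw [e1, e2]
  exact h φ h1 h2 h3 i j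

theorem integrable_coord_mul {μ : Measure (Vec n)} {ι : Type*} [Fintype ι]
    {u : Vec n → EuclideanSpace ℝ ι}
    (hu : Integrable u μ) (i : ι) {ψ : Vec n → ℝ} (hψ : Continuous ψ) (hs : HasCompactSupport ψ) :
    Integrable (fun x => u x i * ψ x) μ := by
  obtain ⟨C, hC⟩ := hs.exists_bound_of_continuous hψ
  exact ((EuclideanSpace.proj (𝕜 := ℝ) i).integrable_comp hu).mul_bdd
    hψ.aestronglyMeasurable (Eventually.of_forall hC)

theorem IsWeakGradient.add {u u' : Vec n → Vec N} {G G' : Vec n → Mat N n}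
    (h : IsWeakGradient Ω u G) (h' : IsWeakGradient Ω u' G')
    (hu : Integrable u (leb Ω)) (hu' : Integrable u' (leb Ω))
    (hG : Integrable G (leb Ω)) (hG' : Integrable G' (leb Ω)) :
    IsWeakGradient Ω (u + u') (G + G') := by
  intro φ h1 h2 h3 i j
  have c1 : Continuous fun x => fderiv ℝ φ x (EuclideanSpace.single j 1) :=
    (h1.continuous_fderiv (by simp)).clm_apply continuous_const
  have c2 : HasCompactSupport fun x => fderiv ℝ φ x (EuclideanSpace.single j 1) :=
    h2.fderiv_apply ℝ _
  simp only [Pi.add_apply, PiLp.add_apply, add_mul]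
  rw [integral_add (integrable_coord_mul hu i c1 c2) (integrable_coord_mul hu' i c1 c2),
    integral_add (integrable_coord_mul hG (i, j) h1.continuous h2)
      (integrable_coord_mul hG' (i, j) h1.continuous h2),
    h φ h1 h2 h3 i j, h' φ h1 h2 h3 i j, neg_add]

theorem IsWeakGradient.smul {u : Vec n → Vec N} {G : Vec n → Mat N n}
    (h : IsWeakGradient Ω u G) (c : ℝ) : IsWeakGradient Ω (c • u) (c • G) := by
  intro φ h1 h2 h3 i j
  simp only [Pi.smul_apply, PiLp.smul_apply, smul_eq_mul, mul_assoc]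
  rw [integral_const_mul, integral_const_mul, h φ h1 h2 h3 i j, mul_neg]

theorem IsWeakGradient.zero : IsWeakGradient Ω (0 : Vec n → Vec N) (0 : Vec n → Mat N n) := by
  intro φ _ _ _ i j
  simp

variable (N Ω)

/-- The weak gradients of `W^{1,1}` functions, as a subspace of `L¹`. -/
def gradientSubmodule : Submodule ℝ (Lp (Mat N n) 1 (leb Ω)) where
  carrier := Set.range W11.grad
  zero_mem' := ⟨⟨0, 0, IsWeakGradient.zero.congr_ae (Lp.coeFn_zero _ _ _)
    (Lp.coeFn_zero _ _ _)⟩, rfl⟩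
  add_mem' := by
    rintro _ _ ⟨w, rfl⟩ ⟨w', rfl⟩
    exact ⟨⟨w.val + w'.val, w.grad + w'.grad,
      (w.isWeakGradient.add w'.isWeakGradient (L1.integrable_coeFn _) (L1.integrable_coeFn _)
        (L1.integrable_coeFn _) (L1.integrable_coeFn _)).congr_ae (Lp.coeFn_add _ _)
        (Lp.coeFn_add _ _)⟩, rfl⟩
  smul_mem' := by
    rintro c _ ⟨w, rfl⟩
    exact ⟨⟨c • w.val, c • w.grad, (w.isWeakGradient.smul c).congr_ae (Lp.coeFn_smul _ _)
      (Lp.coeFn_smul _ _)⟩, rfl⟩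

theorem nonempty_W11 : Nonempty (W11 N Ω) := by
  obtain ⟨w, -⟩ := (gradientSubmodule N Ω).zero_mem
  exact ⟨w⟩

end Sobolev

/-! ### Weak and strong duality, and the weak-* limit -/

section Duality

variable {N n : ℕ} {Ω : Set (Vec n)} [IsFiniteMeasure (leb Ω)] {F : Mat N n → ℝ} {L : ℝ}
  {T₀ χ : Lp (Mat N n) ∞ (leb Ω)}

omit [IsFiniteMeasure (leb Ω)] in
theorem measurable_add_coeFn (T₀ χ : Lp (Mat N n) ∞ (leb Ω)) :
    Measurable fun x => T₀ x + χ x :=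
  (Lp.stronglyMeasurable T₀).measurable.add (Lp.stronglyMeasurable χ).measurable

omit [IsFiniteMeasure (leb Ω)] in
theorem exists_ae_norm_add_le (T₀ χ : Lp (Mat N n) ∞ (leb Ω)) :
    ∃ B, ∀ᵐ x ∂leb Ω, ‖T₀ x + χ x‖ ≤ B := by
  obtain ⟨B, hB⟩ := Lp.exists_ae_norm_le T₀
  obtain ⟨C, hC⟩ := Lp.exists_ae_norm_le χ
  refine ⟨B + C, ?_⟩
  filter_upwards [hB, hC] with x h1 h2
  exact (norm_add_le _ _).trans (add_le_add h1 h2)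

theorem inner_sub_le_of_conjugate_eq {q : Mat N n} {c : ℝ} (h : conjugate F q = c)
    (z : Mat N n) : inner ℝ q z - F z ≤ c := by
  have h1 := le_iSup (fun z : Mat N n => ((inner ℝ q z - F z : ℝ) : EReal)) z
  have h2 : ((inner ℝ q z - F z : ℝ) : EReal) ≤ c := h ▸ h1
  exact_mod_cast h2

/-- The gap in the Fenchel inequality is integrable, and its integral is the duality gap. -/
theorem integral_fenchel_gap (hF : ∀ y z, |F y - F z| ≤ L * ‖y - z‖) (hcont : Continuous F)
    (hχ : χ ∈ LinftyPerp N Ω) {f : Vec n → ℝ} (hf : Integrable f (leb Ω)) (w : W11 N Ω) :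
    Integrable (fun x => F (w.grad x) + f x - inner ℝ (T₀ x + χ x) (w.grad x)) (leb Ω) ∧
      ∫ x, (F (w.grad x) + f x - inner ℝ (T₀ x + χ x) (w.grad x)) ∂leb Ω
        = primal F T₀ w + ∫ x, f x ∂leb Ω := by
  obtain ⟨B, hB⟩ := Lp.exists_ae_norm_le T₀
  obtain ⟨C, hC⟩ := Lp.exists_ae_norm_le χ
  have hw := L1.integrable_coeFn w.grad
  have h1 := integrable_sub_inner hF hcont (Lp.aestronglyMeasurable T₀) hB hw
  have h2 := Integrable.inner_of_bound (Lp.aestronglyMeasurable χ) hC hw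
  have heq : (fun x => F (w.grad x) + f x - inner ℝ (T₀ x + χ x) (w.grad x)) = fun x =>
      (F (w.grad x) - inner ℝ (T₀ x) (w.grad x)) + f x - inner ℝ (χ x) (w.grad x) := by
    ext x
    rw [inner_add_left]
    ring
  rw [heq]
  have h3 : Integrable (fun x => (F (w.grad x) - inner ℝ (T₀ x) (w.grad x)) + f x) (leb Ω) :=
    h1.add hf
  refine ⟨h3.sub h2, ?_⟩
  rw [integral_sub h3 h2, integral_add h1 hf, hχ w, sub_zero, primal]

theorem dual_le_primal (hF : ∀ y z, |F y - F z| ≤ L * ‖y - z‖) (hcont : Continuous F)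
    (hχ : χ ∈ LinftyPerp N Ω) (w : W11 N Ω) : dual Ω F T₀ χ ≤ primal F T₀ w := by
  rw [dual]
  rcases erealIntegral_conjugate (F := F) (μ := leb Ω) (measurable_add_coeFn T₀ χ) with
    h | ⟨f, hf, hae, h⟩
  · rw [h, EReal.neg_top]
    exact bot_le
  · rw [h, ← EReal.coe_neg, EReal.coe_le_coe_iff]
    obtain ⟨-, h2⟩ := integral_fenchel_gap (T₀ := T₀) hF hcont hχ hf w
    have h3 : 0 ≤ ∫ x, (F (w.grad x) + f x - inner ℝ (T₀ x + χ x) (w.grad x)) ∂leb Ω := by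
      refine integral_nonneg_of_ae ?_
      filter_upwards [hae] with x hx
      have := inner_sub_le_of_conjugate_eq hx (w.grad x)
      show 0 ≤ F (w.grad x) + f x - inner ℝ (T₀ x + χ x) (w.grad x)
      linarith
    linarith

theorem exists_le_dual (hc : ConvexOn ℝ Set.univ F) (hL : 0 ≤ L)
    (hF : ∀ y z, |F y - F z| ≤ L * ‖y - z‖) (hcont : Continuous F) {m : ℝ}
    (hm : ∀ w : W11 N Ω, m ≤ primal F T₀ w) :
    ∃ χ ∈ LinftyPerp N Ω, (m : EReal) ≤ dual Ω F T₀ χ := by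
  obtain ⟨B, hB⟩ := Lp.exists_ae_norm_le T₀
  obtain ⟨χ, h1, h2⟩ := exists_annihilator_le_integral hc hL hF hcont
    (Lp.aestronglyMeasurable T₀) hB (gradientSubmodule N Ω) (m := m) (by
      rintro _ ⟨w, rfl⟩
      exact hm w)
  obtain ⟨C, hC⟩ := exists_ae_norm_add_le T₀ χ
  obtain ⟨f, hf, hfm, hlub⟩ := exists_integrable_conjugate hF hcont (measurable_add_coeFn T₀ χ)
    hC h2
  refine ⟨χ, fun w => h1 _ ⟨w, rfl⟩, ?_⟩
  rw [dual, erealIntegral_of_ae_eq_coe hf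
    (hlub.mono fun x hx => conjugate_eq_coe_of_isLUB hx), ← EReal.coe_neg, EReal.coe_le_coe_iff]
  linarith

/-- Integrated coercivity. It makes the primal infimum finite and bounds the gradients of a
minimising sequence in L¹. -/
theorem mul_integral_norm_le_primal (hF : ∀ y z, |F y - F z| ≤ L * ‖y - z‖) (hcont : Continuous F)
    {c C : ℝ} (h : ∀ᵐ x ∂leb Ω, ∀ z, c * ‖z‖ - C ≤ F z - inner ℝ (T₀ x) z) (w : W11 N Ω) :
    c * ∫ x, ‖w.grad x‖ ∂leb Ω - (leb Ω).real Set.univ * C ≤ primal F T₀ w := by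
  obtain ⟨B, hB⟩ := Lp.exists_ae_norm_le T₀
  have hw := L1.integrable_coeFn w.grad
  have h1 : ∫ x, (c * ‖w.grad x‖ - C) ∂leb Ω ≤ primal F T₀ w := by
    refine integral_mono_ae ((hw.norm.const_mul c).sub (integrable_const _))
      (integrable_sub_inner hF hcont (Lp.aestronglyMeasurable T₀) hB hw) ?_
    filter_upwards [h] with x hx
    exact hx _
  rwa [integral_sub (hw.norm.const_mul c) (integrable_const _), integral_const_mul, integral_const,
    smul_eq_mul] at h1

/-- The integrated gap at u k is the primal value minus m, so it tends to 0. This applies to every χ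
with dual value m, which is what uniqueness needs. -/
theorem tendstoWeakStar_gradient_sub (hF1 : ContDiff ℝ 1 F) (hL : ∀ z, ‖gradient F z‖ ≤ L)
    (hF : ∀ y z, |F y - F z| ≤ L * ‖y - z‖)
    {c C : ℝ} (hc : 0 < c) (h : ∀ᵐ x ∂leb Ω, ∀ z, c * ‖z‖ - C ≤ F z - inner ℝ (T₀ x) z)
    {m : ℝ} (hχ : χ ∈ LinftyPerp N Ω) (hm : dual Ω F T₀ χ = m) {u : ℕ → W11 N Ω}
    (hu : Tendsto (fun k => primal F T₀ (u k)) atTop (𝓝 m)) :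
    TendstoWeakStar (fun k x => gradient F ((u k).grad x) - T₀ x) χ := by
  obtain ⟨B, hB⟩ := Lp.exists_ae_norm_le T₀
  obtain ⟨D, hD⟩ := exists_ae_norm_add_le T₀ χ
  obtain ⟨B', hB'⟩ := Lp.exists_ae_norm_le χ
  have hmem (k : ℕ) : MemLp (fun x => gradient F ((u k).grad x) - T₀ x) ∞ (leb Ω) := by
    refine MemLp.sub ?_ (Lp.memLp T₀)
    exact memLp_top_of_bound ((continuous_gradient hF1).comp_aestronglyMeasurable
      (Lp.aestronglyMeasurable _)) L (Eventually.of_forall fun x => hL _)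
  refine ⟨hmem, fun g => ?_⟩
  rcases erealIntegral_conjugate (F := F) (μ := leb Ω) (measurable_add_coeFn T₀ χ) with
    h1 | ⟨f, hf, hae, h1⟩
  · rw [dual, h1, EReal.neg_top] at hm
    exact absurd hm.symm (EReal.coe_ne_bot m)
  · rw [dual, h1, ← EReal.coe_neg, EReal.coe_eq_coe_iff] at hm
    have hgap (k : ℕ) := integral_fenchel_gap (T₀ := T₀) hF hF1.continuous hχ hf (u k)
    obtain ⟨b, hb⟩ := hu.bddAbove_range
    have hbd (k : ℕ) : ∫ x, ‖(u k).grad x‖ ∂leb Ω ≤ (b + (leb Ω).real Set.univ * C) / c := by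
      rw [le_div_iff₀ hc]
      have h2 := mul_integral_norm_le_primal hF hF1.continuous h (u k)
      have h3 : primal F T₀ (u k) ≤ b := hb ⟨k, rfl⟩
      linarith
    have h2 := tendsto_integral_inner_gradient_sub hF1 hL
      (measurable_add_coeFn T₀ χ).aestronglyMeasurable hD
      (hae.mono fun x hx => inner_sub_le_of_conjugate_eq hx)
      (fun k => L1.integrable_coeFn (u k).grad) hbd (fun k => (hgap k).1) (by
        simp_rw [(hgap _).2]
        have h3 := hu.add_const (∫ x, f x ∂leb Ω)
        rwa [← hm, neg_add_cancel] at h3) (L1.integrable_coeFn g)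
    have hχi := Integrable.inner_of_bound (Lp.aestronglyMeasurable χ) hB' (L1.integrable_coeFn g)
    have h3 := h2.add_const (∫ x, inner ℝ (χ x) (g x) ∂leb Ω)
    rw [zero_add] at h3
    refine h3.congr fun k => ?_
    have hi : Integrable (fun x => inner ℝ (gradient F ((u k).grad x) - (T₀ x + χ x)) (g x))
        (leb Ω) := by
      refine Integrable.inner_of_bound (C := L + D)
        (((continuous_gradient hF1).comp_aestronglyMeasurable (Lp.aestronglyMeasurable _)).sub
          (measurable_add_coeFn T₀ χ).aestronglyMeasurable) ?_ (L1.integrable_coeFn g)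
      filter_upwards [hD] with x hx
      exact (norm_sub_le _ _).trans (add_le_add (hL _) hx)
    rw [← integral_add hi hχi]
    refine integral_congr_ae (Eventually.of_forall fun x => ?_)
    show inner ℝ (gradient F ((u k).grad x) - (T₀ x + χ x)) (g x) + inner ℝ (χ x) (g x)
      = inner ℝ (gradient F ((u k).grad x) - T₀ x) (g x)
    rw [← inner_add_left]
    congr 1
    abel

/-- The difference σ - σ' is bounded on a finite measure, so it is itself a test function in L¹. -/
theorem TendstoWeakStar.unique {s : ℕ → Vec n → Mat N n} {σ σ' : Lp (Mat N n) ∞ (leb Ω)}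
    (h : TendstoWeakStar s σ) (h' : TendstoWeakStar s σ') : σ = σ' := by
  obtain ⟨B, hB⟩ := Lp.exists_ae_norm_le σ
  obtain ⟨B', hB'⟩ := Lp.exists_ae_norm_le σ'
  have hmem : MemLp (σ - σ' : Lp (Mat N n) ∞ (leb Ω)) 1 (leb Ω) :=
    (Lp.memLp (σ - σ')).mono_exponent le_top
  have h1 := tendsto_nhds_unique (h.2 (hmem.toLp _)) (h'.2 (hmem.toLp _))
  have hi := Integrable.inner_of_bound (Lp.aestronglyMeasurable σ) hB
    (L1.integrable_coeFn (hmem.toLp _))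
  have hi' := Integrable.inner_of_bound (Lp.aestronglyMeasurable σ') hB'
    (L1.integrable_coeFn (hmem.toLp _))
  have hae : (fun x => inner ℝ (σ x) ((hmem.toLp _ : Lp (Mat N n) 1 (leb Ω)) x)
      - inner ℝ (σ' x) ((hmem.toLp _ : Lp (Mat N n) 1 (leb Ω)) x))
      =ᵐ[leb Ω] fun x => ‖σ x - σ' x‖ ^ 2 := by
    filter_upwards [hmem.coeFn_toLp, Lp.coeFn_sub σ σ'] with x h2 h3
    rw [h2, h3, ← inner_sub_left, Pi.sub_apply, real_inner_self_eq_norm_sq]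
  have h2 : ∫ x, ‖σ x - σ' x‖ ^ 2 ∂leb Ω = 0 := by
    rw [← integral_congr_ae hae, integral_sub hi hi', h1, sub_self]
  rw [integral_eq_zero_iff_of_nonneg (fun x => sq_nonneg _) ((hi.sub hi').congr hae)] at h2
  refine Lp.ext ?_
  filter_upwards [h2] with x hx
  have hx : ‖σ x - σ' x‖ ^ 2 = 0 := hx
  rwa [sq_eq_zero_iff, norm_eq_zero, sub_eq_zero] at hx

end Duality

end NeumannDuality

theorem lemma4p11 {N n : ℕ} (Ω : Set (NeumannDuality.Vec n))
    (hΩ_open : IsOpen Ω) (hΩ_bdd : Bornology.IsBounded Ω)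
    (F : NeumannDuality.Mat N n → ℝ) (hF_smooth : ContDiff ℝ 1 F)
    (hF_conv : ConvexOn ℝ Set.univ F) (hF_growth : NeumannDuality.HasLinearGrowth F)
    (T₀ : Lp (NeumannDuality.Mat N n) ∞ (NeumannDuality.leb Ω))
    (hT₀ : NeumannDuality.StrictlyCoercive Ω F T₀) :
    (∃ σ : Lp (NeumannDuality.Mat N n) ∞ (NeumannDuality.leb Ω),
      NeumannDuality.IsDualMaximiser F T₀ σ ∧
      (∀ σ' : Lp (NeumannDuality.Mat N n) ∞ (NeumannDuality.leb Ω),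
        NeumannDuality.IsDualMaximiser F T₀ σ' → σ' = σ) ∧
      ∀ u : ℕ → NeumannDuality.W11 N Ω, NeumannDuality.IsMinimisingSeq F T₀ u →
        NeumannDuality.TendstoWeakStar (fun k x => gradient F ((u k).grad x) - T₀ x) σ) ∧
    NeumannDuality.primalInf Ω F T₀ = NeumannDuality.dualSup Ω F T₀ := by
  open NeumannDuality in
  have : IsFiniteMeasure (leb Ω) := ⟨by simpa using hΩ_bdd.measure_lt_top⟩
  have := nonempty_W11 N Ω
  have hd : Differentiable ℝ F := hF_smooth.differentiable one_ne_zero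
  have hcont := hF_smooth.continuous
  obtain ⟨B, hB⟩ := Lp.exists_ae_norm_le T₀
  obtain ⟨c, hc, C, hcoer⟩ := hT₀.exists_le hF_conv hd hF_growth hB
  obtain ⟨ν, L, hν, hνL, hgr⟩ := hF_growth
  have hL : 0 ≤ L := hν.le.trans hνL
  have hgrad := hF_conv.norm_gradient_le hd hL fun z => (hgr z).2
  have hlip := hF_conv.abs_sub_le_of_linear_growth hd hL fun z => (hgr z).2
  have hbdd : BddBelow (Set.range fun w : W11 N Ω => primal F T₀ w) := by
    refine ⟨-((leb Ω).real Set.univ * C), ?_⟩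
    rintro _ ⟨w, rfl⟩
    have h1 := mul_integral_norm_le_primal hlip hcont hcoer w
    have h2 : 0 ≤ c * ∫ x, ‖w.grad x‖ ∂leb Ω :=
      mul_nonneg hc.le (integral_nonneg fun x => norm_nonneg _)
    show -((leb Ω).real Set.univ * C) ≤ primal F T₀ w
    linarith
  set m : ℝ := ⨅ w : W11 N Ω, primal F T₀ w
  have hm : primalInf Ω F T₀ = (m : EReal) :=
    (EReal.coe_strictMono.monotone.map_ciInf_of_continuousAt
      continuous_coe_real_ereal.continuousAt hbdd).symm
  have hweak (χ : Lp (Mat N n) ∞ (leb Ω)) (hχ : χ ∈ LinftyPerp N Ω) : dual Ω F T₀ χ ≤ m := by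
    rw [← hm]
    exact le_iInf fun w => dual_le_primal hlip hcont hχ w
  obtain ⟨σ, hσ, hσm⟩ := exists_le_dual hF_conv hL hlip hcont (T₀ := T₀)
    fun w => ciInf_le hbdd w
  have hσeq : dual Ω F T₀ σ = m := le_antisymm (hweak σ hσ) hσm
  have hconv (χ : Lp (Mat N n) ∞ (leb Ω)) (hχ : χ ∈ LinftyPerp N Ω) (hχm : dual Ω F T₀ χ = m)
      (u : ℕ → W11 N Ω) (hu : IsMinimisingSeq F T₀ u) :
      TendstoWeakStar (fun k x => gradient F ((u k).grad x) - T₀ x) χ := by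
    rw [IsMinimisingSeq, hm, EReal.tendsto_coe] at hu
    exact tendstoWeakStar_gradient_sub hF_smooth hgrad hlip hc hcoer hχ hχm hu
  -- Uniqueness compares two maximisers through a common minimising sequence, so one has to exist.
  obtain ⟨u, hu⟩ : ∃ u : ℕ → W11 N Ω, IsMinimisingSeq F T₀ u := by
    obtain ⟨v, -, hv, hvmem⟩ := exists_seq_tendsto_sInf
      (Set.range_nonempty fun w : W11 N Ω => (primal F T₀ w : EReal)) (OrderBot.bddBelow _)
    choose u hu using hvmem
    refine ⟨u, ?_⟩
    rw [IsMinimisingSeq]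
    simp_rw [hu]
    exact hv
  refine ⟨⟨σ, ⟨hσ, fun χ hχ => (hweak χ hχ).trans hσm⟩, fun σ' hσ' => ?_, hconv σ hσ hσeq⟩, ?_⟩
  · have hσ'eq : dual Ω F T₀ σ' = m :=
      le_antisymm (hweak σ' hσ'.1) (hσm.trans (hσ'.2 σ hσ))
    exact (hconv σ' hσ'.1 hσ'eq u hu).unique (hconv σ hσ hσeq u hu)
  · rw [hm]
    refine le_antisymm (hσm.trans ?_) (iSup₂_le hweak)
    exact le_iSup₂ (f := fun (χ : Lp (Mat N n) ∞ (leb Ω)) (_ : χ ∈ LinftyPerp N Ω) =>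
      dual Ω F T₀ χ) σ hσ
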